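/- **Proposition (global energy stability).** *Setting.* Let $1\le d\le 3$ and let $\mathcal T$ be a finite conforming triangulation into open $d$-simplices $K$ of a bounded open set $\Omega\subset\mathbb R^d$ (that is, $\Omega$ is the interior of the union of the closed cells, and closed cells meet in common faces or not at all), with facets $F$ and outward unit normal $n$ on each $\partial K$. Let $\partial\Omega=\Gamma_D\cup\Gamma_N$ with $\Gamma_D,\Gamma_N$ disjoint Borel sets. Let $h_K>0$ be cell sizes; on a facet, $h_K$ denotes the average of the sizes of the adjacent cells. The mesh is called $\sigma$-regular if every $K$ contains a ball of radius $r$ with $h_K\le\sigma r$, and $h_K\le\sigma h_{K'}$ whenever $K,K'$ share a facet. For orders $k>0$ and $\bar k,m,\bar m\ge 0$ let $V_h$ (resp. $Q_h$) be the $\mathbb R^d$-valued (resp. scalar) functions that are polynomials of degree $\le k$ (resp. $\le m$) on each cell, with no continuity between cells, and let $\bar V_h$ (resp. $\bar Q_h$) be the $\mathbb R^d$-valued (resp. scalar) functions on the union of all facets that are polynomials of degree $\le\bar k$ (resp. $\le\bar m$) on each facet, those in $\bar V_h$ vanishing a.e. on $\Gamma_D$. Each of $\bar V_h$, $\bar Q_h$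 may also be replaced by its subspace of continuous functions. Let $\nu\ge0$, $\beta\ge0$, $\alpha>0$, $\chi\in[0,1]$. For $U=(u,\bar u,p,\bar p)$ put $\nabla^su=\frac12(\nabla u+\nabla u^T)$ with $[\nabla u]_{ij}=\partial u_i/\partial x_j$, $$\hat u=u-\tfrac{\beta h_K}{1+\nu}(\bar p-p)n,\qquad \sigma_d=pI-2\nu\nabla^su,\qquad \hat\sigma_d=\bar pI-2\nu\nabla^su-\tfrac{\alpha}{h_K}2\nu(\bar u-u)\otimes n,$$ let $\lambda=1$ where $\hat u\cdot n<0$ and $\lambda=0$ elsewhere on $\partial K$, and let $\lambda_N=1$ where $\bar u\cdot n<0$ and $\lambda_N=0$ elsewhere on $\Gamma_N$. With forcing $f$ and Neumann data $h$, define $$F_c(U;q)=\sum_K\int_K u\cdot\nabla q\,dx-\sum_K\int_{\partial K}\hat u\cdot n\,q\,ds,\qquad \bar F_c(U;\bar q)=\sum_K\int_{\partial K}\hat u\cdot n\,\bar q\,ds-\int_{\partial\Omega}\bar u\cdot n\,\bar q\,ds,$$ $$\begin{aligned}F_m(U;v)={}&\int_\Omega\partial_tu\cdot v\,dx-\chi\sum_K\int_K(u\otimes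 u):\nabla v\,dx+(1-\chi)\sum_K\int_K(\nabla u\,u)\cdot v\,dx+\chi\sum_K\int_{\partial K}(\hat u\cdot n)\,u\cdot v\,ds\\&+\sum_K\int_{\partial K}\lambda(\hat u\cdot n)(\bar u-u)\cdot v\,ds-\sum_K\int_K\sigma_d:\nabla v\,dx+\sum_K\int_{\partial K}\hat\sigma_dn\cdot v\,ds\\&+\sum_K\int_{\partial K}2\nu(\bar u-u)\cdot\nabla^sv\,n\,ds-\int_\Omega f\cdot v\,dx,\end{aligned}$$ $$\begin{aligned}\bar F_m(U;\bar v)={}&\chi\sum_K\int_{\partial K}(\hat u\cdot n)\,u\cdot\bar v\,ds-(1-\chi)\sum_K\int_{\partial K}(\hat u\cdot n)(\bar u-u)\cdot\bar v\,ds+\sum_K\int_{\partial K}\lambda(\hat u\cdot n)(\bar u-u)\cdot\bar v\,ds\\&+\sum_K\int_{\partial K}\hat\sigma_dn\cdot\bar v\,ds-\int_{\Gamma_N}(\chi-\lambda_N)(\bar u\cdot n)\,\bar u\cdot\bar v\,ds-\int_{\Gamma_N}h\cdot\bar v\,ds.\end{aligned}$$ A solution of the semi-discrete scheme on $I=(0,t_N]$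 is a map $t\mapsto U_h(t)=(u_h,\bar u_h,p_h,\bar p_h)(t)\in V_h\times\bar V_h\times Q_h\times\bar Q_h$, with $u_h$ differentiable in $t$ on $I$ (from the left at $t_N$), such that for all $t\in I$ and all $(v,\bar v,q,\bar q)\in V_h\times\bar V_h\times Q_h\times\bar Q_h$ $$F_m(U_h;v)+\bar F_m(U_h;\bar v)+F_c(U_h;q)+\bar F_c(U_h;\bar q)=0 .$$ *Claim.* For all $d$, $k$ and $\sigma\ge1$ there is $\alpha_0>0$, depending only on $d$, $k$ and $\sigma$ (in particular not on the cell sizes, $\nu$, $\beta$ or the solution), such that on every $\sigma$-regular mesh and for every $\alpha\ge\alpha_0$, every solution $U_h$ of the semi-discrete scheme with $\chi=\frac12$, $f=0$ and homogeneous boundary conditions ($\bar u_h=0$ on $\Gamma_D$, $h=0$ on $\Gamma_N$) satisfies $$\frac{d}{dt}\int_\Omega|u_h|^2\,dx\le0\qquad\text{for all }t\in I,$$ where the derivative exists, and hence $\int_\Omega|u_h|^2\,dx$ is non-increasing on $I$. -/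

import Mathlib

open MeasureTheory Set
open scoped Matrix

noncomputable section

namespace HybridNS

/-- Euclidean space `ℝ^d`. -/
abbrev E (d : ℕ) := EuclideanSpace ℝ (Fin d)

/-- Scalar polynomials in the `d` space coordinates. -/
abbrev Poly (d : ℕ) := MvPolynomial (Fin d) ℝ

/-! ### Meshes -/

/-- A conforming simplicial triangulation of the open set `Ω ⊆ ℝ^d`: a finite simplicial complex
(simplices are given by their vertex sets), all of whose simplices are faces of `d`-simplices, such
that `Ω` is the interior of the union of all (closed) simplices. -/
structure Triangulation (d : ℕ) (Ω : Set (E d)) where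
  complex : Geometry.SimplicialComplex ℝ (E d)
  finite : complex.faces.Finite
  pure : ∀ s ∈ complex.faces, ∃ K ∈ complex.faces, s ⊆ K ∧ K.card = d + 1
  domain_eq : Ω = interior complex.space

variable {d : ℕ} {Ω : Set (E d)}

/-- The closed simplex with vertex set `s`. -/
def closedCell (s : Finset (E d)) : Set (E d) := convexHull ℝ (s : Set (E d))

/-- The open cell with vertex set `K`. -/
def openCell (K : Finset (E d)) : Set (E d) := interior (closedCell K)

namespace Triangulation

/-- The cells `K` (by vertex sets): the `d`-simplices. -/
def cells (T : Triangulation d Ω) : Finset (Finset (E d)) :=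
  T.finite.toFinset.filter (fun s => s.card = d + 1)

/-- The facets `F` (by vertex sets): the `(d-1)`-simplices. -/
def facets (T : Triangulation d Ω) : Finset (Finset (E d)) :=
  T.finite.toFinset.filter (fun s => s.card = d)

open Classical in
/-- The facets that make up `∂K`. -/
def facetsOf (T : Triangulation d Ω) (K : Finset (E d)) : Finset (Finset (E d)) :=
  T.facets.filter (fun F => F ⊆ K)

open Classical in
/-- The cells that have `F` as a facet. -/
def cellsAt (T : Triangulation d Ω) (F : Finset (E d)) : Finset (Finset (E d)) :=
  T.cells.filter (fun K => F ⊆ K)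

/-- The exterior facets of `K`, i.e. those which belong to no other cell; over all `K` they make up
the boundary `∂Ω`. -/
def exteriorFacetsOf (T : Triangulation d Ω) (K : Finset (E d)) : Finset (Finset (E d)) :=
  (T.facetsOf K).filter (fun F => (T.cellsAt F).card = 1)

/-- Given sizes `h K` of the cells, the size used on the facet `F`: the average over the cells
adjacent to `F` (so just `h K` on an exterior facet). -/
def facetSize (T : Triangulation d Ω) (h : Finset (E d) → ℝ) (F : Finset (E d)) : ℝ :=
  (∑ K ∈ T.cellsAt F, h K) / ((T.cellsAt F).card : ℝ)

/-- Regularity of the mesh with constant `σ`, for the positive cell sizes `h`: every cell `K`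
contains a ball of radius at least `h K / σ`, and the sizes of cells that share a facet differ
at most by the factor `σ`. -/
def IsRegular (T : Triangulation d Ω) (h : Finset (E d) → ℝ) (σ : ℝ) : Prop :=
  (∀ K ∈ T.cells, 0 < h K) ∧
  (∀ K ∈ T.cells, ∃ c : E d, ∃ r : ℝ, Metric.closedBall c r ⊆ closedCell K ∧ h K ≤ σ * r) ∧
  (∀ F ∈ T.facets, ∀ K ∈ T.cellsAt F, ∀ K' ∈ T.cellsAt F, h K ≤ σ * h K')

end Triangulation

/-- `n` is the unit normal vector to the facet `F` of the simplex `K` that points out of `K`. -/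
def IsOutwardNormal (K F : Finset (E d)) (n : E d) : Prop :=
  ‖n‖ = 1 ∧ (∀ x ∈ F, ∀ y ∈ F, inner ℝ (y - x) n = 0) ∧
    ∀ x ∈ F, ∀ v ∈ K, v ∉ F → inner ℝ (v - x) n < 0

/-- A facet of a nondegenerate simplex has an outward unit normal. -/
theorem exists_isOutwardNormal {K F : Finset (E d)}
    (hK : AffineIndependent ℝ ((↑) : K → E d)) (hF : F.Nonempty) (hFK : F ⊆ K)
    (hcard : K.card = F.card + 1) : ∃ n, IsOutwardNormal K F n := by
  classical
  obtain ⟨x₀, hx₀⟩ := hF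
  have h1 : (K \ F).card = 1 := by rw [Finset.card_sdiff_of_subset hFK]; omega
  obtain ⟨v, hv⟩ := Finset.card_eq_one.1 h1
  have hvK : v ∈ K \ F := by rw [hv]; simp
  rw [Finset.mem_sdiff] at hvK
  let A : AffineSubspace ℝ (E d) := affineSpan ℝ (F : Set (E d))
  have hsub : ∀ x ∈ F, x ∈ A := fun x hx => subset_affineSpan ℝ _ hx
  have : Nonempty A := ⟨⟨x₀, hsub x₀ hx₀⟩⟩
  have hvA : v ∉ A := by
    have := hK.notMem_affineSpan_sdiff ⟨v, hvK.1⟩ Set.univ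
    intro hvA
    apply this
    refine affineSpan_mono ℝ ?_ hvA
    intro y hy
    refine ⟨⟨y, hFK hy⟩, ⟨trivial, ?_⟩, rfl⟩
    intro h
    have h' : y = v := congrArg Subtype.val h
    exact hvK.2 (h' ▸ hy)
  set w : E d := (EuclideanGeometry.orthogonalProjection A v : E d) with hw
  have hwA : w ∈ A := (EuclideanGeometry.orthogonalProjection A v).2
  have hne : w - v ≠ 0 := by
    intro h
    rw [sub_eq_zero] at h
    exact hvA (h ▸ hwA)
  have hpos : 0 < ‖w - v‖ := norm_pos_iff.2 hne
  have horth : ∀ a ∈ A, ∀ b ∈ A, inner ℝ (a - b) (w - v) = 0 := by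
    intro a ha b hb
    have h2 := EuclideanGeometry.vsub_orthogonalProjection_mem_direction_orthogonal A v
    have h3 := (Submodule.mem_orthogonal _ _).1 h2 (a -ᵥ b) (A.vsub_mem_direction ha hb)
    rw [vsub_eq_sub, vsub_eq_sub, ← hw, ← neg_sub w v, inner_neg_right, neg_eq_zero] at h3
    exact h3
  refine ⟨‖w - v‖⁻¹ • (w - v), ?_, ?_, ?_⟩
  · rw [norm_smul, norm_inv, norm_norm, inv_mul_cancel₀ hpos.ne']
  · intro x hx y hy
    rw [inner_smul_right, horth y (hsub y hy) x (hsub x hx), mul_zero]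
  · intro x hx y hy hyF
    have hyv : y = v := by
      have : y ∈ K \ F := Finset.mem_sdiff.2 ⟨hy, hyF⟩
      rw [hv] at this
      simpa using this
    subst hyv
    have h4 : y - x = (w - x) - (w - y) := by abel
    rw [inner_smul_right, h4, inner_sub_left, horth w hwA x (hsub x hx),
      real_inner_self_eq_norm_sq]
    have : 0 < ‖w - y‖⁻¹ * ‖w - y‖ ^ 2 := by positivity
    linarith

open Classical in
/-- The outward unit normal on the facet `F` of the cell `K`, as a coordinate vector. -/
def normal (K F : Finset (E d)) : Fin d → ℝ :=
  if h : ∃ n, IsOutwardNormal K F n then h.choose.ofLp else 0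

/-! ### Piecewise polynomial fields and their derivatives -/

/-- Value of a polynomial at a point. -/
def val (p : Poly d) (x : E d) : ℝ := MvPolynomial.eval x.ofLp p

/-- Value of a polynomial vector field at a point. -/
def vval (u : Fin d → Poly d) (x : E d) : Fin d → ℝ := fun i => val (u i) x

/-- `∇ p`. -/
def grad (p : Poly d) (x : E d) : Fin d → ℝ := fun j => val (MvPolynomial.pderiv j p) x

/-- `[∇ u]ᵢⱼ = ∂uᵢ / ∂xⱼ`. -/
def vgrad (u : Fin d → Poly d) (x : E d) : Matrix (Fin d) (Fin d) ℝ :=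
  Matrix.of fun i j => val (MvPolynomial.pderiv j (u i)) x

/-- The symmetric gradient `∇ˢ u = (∇ u + (∇ u)ᵀ) / 2`. -/
def symGrad (u : Fin d → Poly d) (x : E d) : Matrix (Fin d) (Fin d) ℝ :=
  (2⁻¹ : ℝ) • (vgrad u x + (vgrad u x)ᵀ)

/-- The double contraction `A : B`. -/
def frob (A B : Matrix (Fin d) (Fin d) ℝ) : ℝ := ∑ i, ∑ j, A i j * B i j

/-- A quadruple `(u, ū, p, p̄)`: `u` and `p` are given by one polynomial (per component) on each
cell, `ū` and `p̄` by the restriction to `F` of a polynomial for each facet `F`. -/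
structure Fields (d : ℕ) where
  u : Finset (E d) → Fin d → Poly d
  ub : Finset (E d) → Fin d → Poly d
  p : Finset (E d) → Poly d
  pb : Finset (E d) → Poly d

/-! ### Integrals -/

/-- `∫_K g dx`. -/
def cellInt (K : Finset (E d)) (g : E d → ℝ) : ℝ := ∫ x in openCell K, g x

/-- `∫_F g ds`, with respect to the `(d-1)`-dimensional surface measure. -/
def facetInt (F : Finset (E d)) (g : E d → ℝ) : ℝ :=
  ∫ x in closedCell F, g x ∂(Measure.euclideanHausdorffMeasure (d - 1))

/-- `∫_{F ∩ Γ} g ds`, with respect to the `(d-1)`-dimensional surface measure. -/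
def facetIntOn (Γ : Set (E d)) (F : Finset (E d)) (g : E d → ℝ) : ℝ :=
  ∫ x in closedCell F ∩ Γ, g x ∂(Measure.euclideanHausdorffMeasure (d - 1))

namespace Triangulation

/-- The function that equals `g K` on the open cell `K`, for every cell `K` (and vanishes on the
null set of points of `Ω` that lie in no open cell). -/
def glue (T : Triangulation d Ω) (g : Finset (E d) → E d → ℝ) (x : E d) : ℝ :=
  ∑ K ∈ T.cells, (openCell K).indicator (g K) x

/-- `∫_Ω g dx` for a function `g` given cell by cell. -/
def domInt (T : Triangulation d Ω) (g : Finset (E d) → E d → ℝ) : ℝ := ∫ x in Ω, T.glue g x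

/-- `∑_K ∫_K g dx`. -/
def sumCells (T : Triangulation d Ω) (g : Finset (E d) → E d → ℝ) : ℝ :=
  ∑ K ∈ T.cells, cellInt K (g K)

/-- `∑_K ∫_{∂K} g ds`, where `g K F` is the integrand on the side `K` of the facet `F`. -/
def sumBdry (T : Triangulation d Ω) (g : Finset (E d) → Finset (E d) → E d → ℝ) : ℝ :=
  ∑ K ∈ T.cells, ∑ F ∈ T.facetsOf K, facetInt F (g K F)

/-- `∫_{∂Ω} g ds`. -/
def extInt (T : Triangulation d Ω) (g : Finset (E d) → Finset (E d) → E d → ℝ) : ℝ :=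
  ∑ K ∈ T.cells, ∑ F ∈ T.exteriorFacetsOf K, facetInt F (g K F)

/-- `∫_Γ g ds` for a part `Γ` of `∂Ω`. -/
def extIntOn (T : Triangulation d Ω) (Γ : Set (E d))
    (g : Finset (E d) → Finset (E d) → E d → ℝ) : ℝ :=
  ∑ K ∈ T.cells, ∑ F ∈ T.exteriorFacetsOf K, facetIntOn Γ F (g K F)

end Triangulation

/-! ### The scheme -/

/-- The data of the method: the mesh, the cell sizes `h_K`, the Dirichlet and Neumann parts of the
boundary, the polynomial orders of `V_h`, `V̄_h`, `Q_h`, `Q̄_h`, whether the facet velocities and the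
facet pressures are required to be continuous, the viscosity and the parameters. -/
structure Scheme (d : ℕ) (Ω : Set (E d)) where
  mesh : Triangulation d Ω
  size : Finset (E d) → ℝ
  ΓD : Set (E d)
  ΓN : Set (E d)
  k : ℕ
  kb : ℕ
  m : ℕ
  mb : ℕ
  contU : Prop
  contP : Prop
  ν : ℝ
  α : ℝ
  β : ℝ
  χ : ℝ

namespace Scheme

/-- `h_K` as it is used on a facet. -/
def hF (S : Scheme d Ω) (F : Finset (E d)) : ℝ := S.mesh.facetSize S.size F

/-- The space `V_h`. -/
def InV (S : Scheme d Ω) (v : Finset (E d) → Fin d → Poly d) : Prop :=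
  ∀ K ∈ S.mesh.cells, ∀ i, (v K i).totalDegree ≤ S.k

/-- The space `V̄_h` (or its subspace of continuous functions, if `contU` holds). Vanishing on `Γ_D`
is meant almost everywhere with respect to surface measure. -/
def InVb (S : Scheme d Ω) (v : Finset (E d) → Fin d → Poly d) : Prop :=
  (∀ F ∈ S.mesh.facets, ∀ i, (v F i).totalDegree ≤ S.kb) ∧
  (∀ F ∈ S.mesh.facets, ∀ᵐ x ∂((Measure.euclideanHausdorffMeasure (d - 1) :
      Measure (E d)).restrict (closedCell F ∩ S.ΓD)), vval (v F) x = 0) ∧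
  (S.contU → ∀ F ∈ S.mesh.facets, ∀ F' ∈ S.mesh.facets,
    ∀ x ∈ closedCell F ∩ closedCell F', vval (v F) x = vval (v F') x)

/-- The space `Q_h`. -/
def InQ (S : Scheme d Ω) (q : Finset (E d) → Poly d) : Prop :=
  ∀ K ∈ S.mesh.cells, (q K).totalDegree ≤ S.m

/-- The space `Q̄_h` (or its subspace of continuous functions, if `contP` holds). -/
def InQb (S : Scheme d Ω) (q : Finset (E d) → Poly d) : Prop :=
  (∀ F ∈ S.mesh.facets, (q F).totalDegree ≤ S.mb) ∧
  (S.contP → ∀ F ∈ S.mesh.facets, ∀ F' ∈ S.mesh.facets,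
    ∀ x ∈ closedCell F ∩ closedCell F', val (q F) x = val (q F') x)

/-- The space `V_h × V̄_h × Q_h × Q̄_h`. -/
def InSpace (S : Scheme d Ω) (W : Fields d) : Prop :=
  S.InV W.u ∧ S.InVb W.ub ∧ S.InQ W.p ∧ S.InQb W.pb

/-- The numerical mass flux `û = u - (β h / (ν + 1)) (p̄ - p) n` on the facet `F` of `K`. -/
def uHat (S : Scheme d Ω) (U : Fields d) (K F : Finset (E d)) (x : E d) : Fin d → ℝ :=
  vval (U.u K) x -
    (S.β * S.hF F / (S.ν + 1) * (val (U.pb F) x - val (U.p K) x)) • normal K F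

/-- The normal flux `û · n` on the facet `F` of `K`. -/
def flux (S : Scheme d Ω) (U : Fields d) (K F : Finset (E d)) (x : E d) : ℝ :=
  S.uHat U K F x ⬝ᵥ normal K F

/-- The upwind switch `λ` as a function of the normal velocity: one for inflow, zero else. -/
def upwind (s : ℝ) : ℝ := if s < 0 then 1 else 0

/-- The jump `ū - u` on the facet `F` of `K`. -/
def jump (U : Fields d) (K F : Finset (E d)) (x : E d) : Fin d → ℝ :=
  vval (U.ub F) x - vval (U.u K) x

/-- The diffusive flux `σ_d = p I - 2 ν ∇ˢ u` on the cell `K`. -/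
def sigma (S : Scheme d Ω) (U : Fields d) (K : Finset (E d)) (x : E d) :
    Matrix (Fin d) (Fin d) ℝ :=
  val (U.p K) x • (1 : Matrix (Fin d) (Fin d) ℝ) - (2 * S.ν) • symGrad (U.u K) x

/-- The numerical diffusive flux
`σ̂_d = p̄ I - 2 ν ∇ˢ u - (α / h) 2 ν (ū - u) ⊗ n` on the facet `F` of `K`. -/
def sigmaHat (S : Scheme d Ω) (U : Fields d) (K F : Finset (E d)) (x : E d) :
    Matrix (Fin d) (Fin d) ℝ :=
  val (U.pb F) x • (1 : Matrix (Fin d) (Fin d) ℝ) - (2 * S.ν) • symGrad (U.u K) x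
    - (S.α / S.hF F * (2 * S.ν)) • Matrix.vecMulVec (jump U K F x) (normal K F)

/-- The local continuity functional `F_c(U; q)`. -/
def Fc (S : Scheme d Ω) (U : Fields d) (q : Finset (E d) → Poly d) : ℝ :=
  S.mesh.sumCells (fun K x => vval (U.u K) x ⬝ᵥ grad (q K) x)
  - S.mesh.sumBdry (fun K F x => S.flux U K F x * val (q K) x)

/-- The global continuity functional `F̄_c(U; q̄)`. -/
def Fcb (S : Scheme d Ω) (U : Fields d) (qb : Finset (E d) → Poly d) : ℝ :=
  S.mesh.sumBdry (fun K F x => S.flux U K F x * val (qb F) x)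
  - S.mesh.extInt (fun K F x => (vval (U.ub F) x ⬝ᵥ normal K F) * val (qb F) x)

/-- The local momentum functional `F_m(U; v)`, where `ut` is the time derivative of `u` (given cell
by cell) and `f` is the forcing term. -/
def Fm (S : Scheme d Ω) (f : E d → Fin d → ℝ) (ut : Finset (E d) → E d → Fin d → ℝ)
    (U : Fields d) (v : Finset (E d) → Fin d → Poly d) : ℝ :=
  S.mesh.domInt (fun K x => ut K x ⬝ᵥ vval (v K) x)
  - S.χ * S.mesh.sumCells (fun K x =>
      frob (Matrix.vecMulVec (vval (U.u K) x) (vval (U.u K) x)) (vgrad (v K) x))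
  + (1 - S.χ) * S.mesh.sumCells (fun K x =>
      (vgrad (U.u K) x *ᵥ vval (U.u K) x) ⬝ᵥ vval (v K) x)
  + S.χ * S.mesh.sumBdry (fun K F x =>
      S.flux U K F x * (vval (U.u K) x ⬝ᵥ vval (v K) x))
  + S.mesh.sumBdry (fun K F x =>
      upwind (S.flux U K F x) * S.flux U K F x * (jump U K F x ⬝ᵥ vval (v K) x))
  - S.mesh.sumCells (fun K x => frob (S.sigma U K x) (vgrad (v K) x))
  + S.mesh.sumBdry (fun K F x => (S.sigmaHat U K F x *ᵥ normal K F) ⬝ᵥ vval (v K) x)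
  + S.mesh.sumBdry (fun K F x =>
      2 * S.ν * (jump U K F x ⬝ᵥ (symGrad (v K) x *ᵥ normal K F)))
  - S.mesh.domInt (fun K x => f x ⬝ᵥ vval (v K) x)

/-- The global momentum functional `F̄_m(U; v̄)`, where `g` is the prescribed momentum flux on `Γ_N`.
In the integral over `Γ_N` the advective velocity is `ū`, and the switch `λ` is evaluated with it,
so that `(1 - λ) (ū · n) = max (ū · n) 0`. -/
def Fmb (S : Scheme d Ω) (g : E d → Fin d → ℝ)
    (U : Fields d) (vb : Finset (E d) → Fin d → Poly d) : ℝ :=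
  S.χ * S.mesh.sumBdry (fun K F x =>
      S.flux U K F x * (vval (U.u K) x ⬝ᵥ vval (vb F) x))
  - (1 - S.χ) * S.mesh.sumBdry (fun K F x =>
      S.flux U K F x * (jump U K F x ⬝ᵥ vval (vb F) x))
  + S.mesh.sumBdry (fun K F x =>
      upwind (S.flux U K F x) * S.flux U K F x * (jump U K F x ⬝ᵥ vval (vb F) x))
  + S.mesh.sumBdry (fun K F x => (S.sigmaHat U K F x *ᵥ normal K F) ⬝ᵥ vval (vb F) x)
  - S.mesh.extIntOn S.ΓN (fun K F x =>
      (S.χ - upwind (vval (U.ub F) x ⬝ᵥ normal K F)) * (vval (U.ub F) x ⬝ᵥ normal K F) *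
        (vval (U.ub F) x ⬝ᵥ vval (vb F) x))
  - S.mesh.extIntOn S.ΓN (fun _ F x => g x ⬝ᵥ vval (vb F) x)

/-- The functional `F(U; W) = F_m(U; v) + F̄_m(U; v̄) + F_c(U; q) + F̄_c(U; q̄)`. -/
def residual (S : Scheme d Ω) (f g : E d → Fin d → ℝ) (ut : Finset (E d) → E d → Fin d → ℝ)
    (U W : Fields d) : ℝ :=
  S.Fm f ut U W.u + S.Fmb g U W.ub + S.Fc U W.p + S.Fcb U W.pb

/-- `U` is a solution of the semi-discrete problem on the time interval `I` with forcing term `f`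
and Neumann data `g`: `U t` lies in the finite element space for all `t ∈ I`, the velocity `u`
is differentiable on `I` as a function with values in the finite-dimensional space `V_h` (i.e. all
of its coefficients are), and `F(U; W) = 0` for all `W` in the finite element space at all times. -/
structure IsSolution (S : Scheme d Ω) (f g : ℝ → E d → Fin d → ℝ) (I : Set ℝ)
    (U : ℝ → Fields d) : Prop where
  mem : ∀ t ∈ I, S.InSpace (U t)
  diff : ∀ K ∈ S.mesh.cells, ∀ i, ∀ e : Fin d →₀ ℕ,
    DifferentiableOn ℝ (fun t => MvPolynomial.coeff e ((U t).u K i)) I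
  eq : ∀ t ∈ I, ∀ W : Fields d, S.InSpace W →
    S.residual (f t) (g t)
      (fun K x i => derivWithin (fun s => val ((U s).u K i) x) I t) (U t) W = 0

/-- The standing assumptions on the data: `Γ_D` and `Γ_N` are disjoint (Borel) sets with union
`∂Ω`, `k > 0`, `ν ≥ 0`, `β ≥ 0` and `χ ∈ [0, 1]`. -/
structure IsAdmissible (S : Scheme d Ω) : Prop where
  measurableD : MeasurableSet S.ΓD
  measurableN : MeasurableSet S.ΓN
  disjoint : Disjoint S.ΓD S.ΓN
  union : S.ΓD ∪ S.ΓN = frontier Ω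
  k_pos : 0 < S.k
  ν_nonneg : 0 ≤ S.ν
  β_nonneg : 0 ≤ S.β
  χ_mem : S.χ ∈ Icc (0 : ℝ) 1

/-- The total kinetic energy (times two) `∫_Ω |u|² dx`. -/
def energy (S : Scheme d Ω) (U : Fields d) : ℝ :=
  S.mesh.domInt (fun K x => vval (U.u K) x ⬝ᵥ vval (U.u K) x)

end Scheme

end HybridNS

end

/-! The scheme is tested with `(u, -ū, -p, -p̄)`. For `χ = 1/2` the two convective cell terms
cancel, since `(u ⊗ u) : ∇u = (∇u u) · u`. Integration by parts on each cell turns the pressure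
terms into `∫_{∂K} p u · n`. As `p̄ ū` is single valued on facets and normals of neighbouring cells
are opposite, the sum of `p̄ ū · n` over all cell boundaries reduces to `∂Ω`, where it cancels the
boundary term of the continuity functional. With `j = ū - u`, what remains on `∂K` is the integrand
`dissipation`, equal to `|û · n| |j|² / 2 + 4ν j · (∇ˢu n) + 2ν (α/h) |j|² + βh/(1+ν) (p̄ - p)²`.
Half the derivative of the energy is therefore minus the sum of `2ν ∑ ∫_K |∇ˢu|²`, the dissipation,
and the nonnegative term `∫_{Γ_N} |ū · n| |ū|² / 2`.

Only the consistency term `4ν j · (∇ˢu n)` has no sign. Young's inequality spends the whole penalty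
on it and leaves `-2ν (h/α) |∇ˢu|²` on the facets. The discrete trace inequality `∑_F h_F ∫_F |∇ˢu|²
≤ C ∫_K |∇ˢu|²` (`exists_trace_symGrad`), with `C` depending on `d`, `k`, `σ` only, lets the cell
terms absorb this as soon as `α ≥ C`.

Both the integration by parts (`cellInt_grad`) and the trace inequality (`exists_trace_simplex`) are
obtained in affine coordinates `(y, t)` for which a facet is the base `t = 0` of a reference
simplex. The former is the fundamental theorem of calculus in `t`, extended from edges to all
directions by linearity. The latter is finite dimensionality on the reference simplex; scaling
brings in the height of the cell, which is at least the diameter of an inscribed ball. Opposite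
normals (`normal_eq_neg`) come from conformity: distinct cells cannot lie on the same side of a
common facet. -/

noncomputable section

namespace HybridNS

/-! ### Affine parametrisations of simplices -/

/-- The linear map `y ↦ ∑ yⱼ eⱼ`. -/
def edgeMap {n d : ℕ} (e : Fin n → E d) : E n →ₗ[ℝ] E d :=
  (Fintype.linearCombination ℝ e).comp (WithLp.linearEquiv 2 ℝ (Fin n → ℝ)).toLinearMap

theorem edgeMap_apply {n d : ℕ} (e : Fin n → E d) (y : E n) : edgeMap e y = ∑ j, y j • e j := rfl

theorem edgeMap_injective {n d : ℕ} {e : Fin n → E d} (he : LinearIndependent ℝ e) :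
    Function.Injective (edgeMap e) := by
  have := linearIndependent_iff_injective_fintypeLinearCombination.1 he
  exact this.comp (WithLp.linearEquiv 2 ℝ (Fin n → ℝ)).injective

theorem edgeMap_measurableEmbedding {n d : ℕ} {e : Fin n → E d} (he : LinearIndependent ℝ e)
    (w : E d) : MeasurableEmbedding fun y => w + edgeMap e y := by
  have hc : Continuous (edgeMap e) := (edgeMap e).continuous_of_finiteDimensional
  exact (continuous_const.add hc).measurableEmbedding
    ((add_right_injective w).comp (edgeMap_injective he))

/-- `normDet` is the Jacobian of the linear part, and translation by `w` is an isometry. -/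
theorem hausdorff_image_edgeMap {n d : ℕ} (e : Fin n → E d) (w : E d) (s : Set (E n)) :
    Measure.euclideanHausdorffMeasure n ((fun y => w + edgeMap e y) '' s) =
      ENNReal.ofReal (edgeMap e).normDet * volume s := by
  have h := (edgeMap e).euclideanHausdorffMeasure_image_eq_normDet_mul_volume s
  rw [finrank_euclideanSpace_fin] at h
  rw [← h, ← (isometry_add_left w).euclideanHausdorffMeasure_image (edgeMap e '' s), Set.image_image]

/-- Surface integrals in an affine parametrisation. -/
theorem setIntegral_hausdorff_image_edgeMap {n d : ℕ} {e : Fin n → E d}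
    (he : LinearIndependent ℝ e) (w : E d) (s : Set (E n)) (g : E d → ℝ) :
    ∫ x in (fun y => w + edgeMap e y) '' s, g x ∂(Measure.euclideanHausdorffMeasure n) =
      (edgeMap e).normDet * ∫ y in s, g (w + edgeMap e y) := by
  have hφ := edgeMap_measurableEmbedding he w
  have hm : (Measure.euclideanHausdorffMeasure n).restrict ((fun y => w + edgeMap e y) '' s) =
      ENNReal.ofReal (edgeMap e).normDet •
        (volume.restrict s).map (fun y => w + edgeMap e y) := by
    ext A hA
    rw [Measure.restrict_apply hA, Measure.smul_apply, hφ.map_apply,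
      Measure.restrict_apply (hφ.measurable hA), smul_eq_mul, ← hausdorff_image_edgeMap e w]
    congr 1
    ext x
    constructor
    · rintro ⟨h, ⟨y, hy, rfl⟩⟩
      exact ⟨y, ⟨h, hy⟩, rfl⟩
    · rintro ⟨y, ⟨h, hy⟩, rfl⟩
      exact ⟨h, ⟨y, hy, rfl⟩⟩
  rw [hm, integral_smul_measure, hφ.integral_map,
    ENNReal.toReal_ofReal (LinearMap.normDet_nonneg _), smul_eq_mul]

/-- The affine map `(y, t) ↦ w + ∑ yⱼ eⱼ + t a`. -/
def prismMap {n d : ℕ} (e : Fin n → E d) (w a : E d) (z : E n × ℝ) : E d :=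
  w + edgeMap e z.1 + z.2 • a

theorem continuous_prismMap {n d : ℕ} (e : Fin n → E d) (w a : E d) :
    Continuous (prismMap e w a) := by
  have hc : Continuous (edgeMap e) := (edgeMap e).continuous_of_finiteDimensional
  unfold prismMap
  fun_prop

theorem inner_edgeMap {n d : ℕ} {e : Fin n → E d} {ν : E d} (h : ∀ j, inner ℝ (e j) ν = 0)
    (y : E n) : inner ℝ (edgeMap e y) ν = 0 := by
  simp [edgeMap_apply, sum_inner, inner_smul_left, h]

/-- Pairing with `ν` annihilates the edges and so recovers `t`; independence of the edges then
recovers `y`. -/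
theorem prismMap_injective {n d : ℕ} {e : Fin n → E d} (he : LinearIndependent ℝ e)
    {ν a : E d} (h : ∀ j, inner ℝ (e j) ν = 0) (ha : inner ℝ a ν ≠ 0) (w : E d) :
    Function.Injective (prismMap e w a) := by
  rintro ⟨y, t⟩ ⟨y', t'⟩ hz
  simp only [prismMap] at hz
  have ht : t = t' := by
    have := congrArg (fun x => inner ℝ (x - w) ν) hz
    simp only [inner_sub_left, inner_add_left, inner_edgeMap h, inner_smul_left] at this
    simpa [ha] using this
  subst ht
  have : edgeMap e y = edgeMap e y' := by simpa using hz
  rw [edgeMap_injective he this]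

/-- Base times height: Lebesgue measure in the coordinates `(y, t)`. -/
theorem volume_eq_smul_map_prismMap {n : ℕ} {e : Fin n → E (n + 1)} (he : LinearIndependent ℝ e)
    {ν a : E (n + 1)} (hν : ‖ν‖ = 1) (h : ∀ j, inner ℝ (e j) ν = 0) (ha : inner ℝ a ν ≠ 0)
    (w : E (n + 1)) :
    (volume : Measure (E (n + 1))) =
      ENNReal.ofReal (|inner ℝ a ν| * (edgeMap e).normDet) •
        (volume : Measure (E n × ℝ)).map (prismMap e w a) := by
  set η : ℝ := inner ℝ a ν with hη
  have hν0 : ν ≠ 0 := by rintro rfl; simp at hν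
  have hcont := continuous_prismMap e w a
  -- The edges span all of `νᗮ`, since both spaces have dimension `n`.
  have hrange : ∀ x : E (n + 1), inner ℝ x ν = 0 → ∃ y, edgeMap e y = x := by
    have hle : LinearMap.range (edgeMap e) ≤ (ℝ ∙ ν)ᗮ := by
      rintro _ ⟨y, rfl⟩
      rw [Submodule.mem_orthogonal_singleton_iff_inner_left]
      exact inner_edgeMap h y
    have heq := Submodule.eq_of_le_of_finrank_eq hle (by
      rw [LinearMap.finrank_range_of_inj (edgeMap_injective he), finrank_euclideanSpace_fin]
      have : Fact (Module.finrank ℝ (E (n + 1)) = n + 1) := ⟨finrank_euclideanSpace_fin⟩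
      exact (Submodule.finrank_orthogonal_span_singleton hν0).symm)
    intro x hx
    have : x ∈ (ℝ ∙ ν)ᗮ := Submodule.mem_orthogonal_singleton_iff_inner_left.2 hx
    rwa [← heq] at this
  ext A hA
  -- The hyperplane at signed height `τ` over `w` is the slice `t = τ / η`, because a step `t • a`
  -- raises the height by `t * η`.
  have hslice : ∀ τ : ℝ, A ∩ (AffineSubspace.mk' (τ • ν +ᵥ w) (ℝ ∙ ν)ᗮ : Set (E (n + 1))) =
      (fun y => (w + (τ / η) • a) + edgeMap e y) ''
        {y | prismMap e w a (y, η⁻¹ * τ) ∈ A} := by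
    intro τ
    ext x
    simp only [mem_inter_iff, SetLike.mem_coe, AffineSubspace.mem_mk',
      Submodule.mem_orthogonal_singleton_iff_inner_left, prismMap, mem_image, mem_ofPred_eq,
      vsub_eq_sub, vadd_eq_add]
    constructor
    · rintro ⟨hxA, hx⟩
      obtain ⟨y, hy⟩ := hrange (x - (w + (τ / η) • a)) (by
        have : inner ℝ (x - w) ν = τ := by
          rw [inner_sub_left, inner_add_left, inner_smul_left, real_inner_self_eq_norm_sq, hν] at hx
          simp only [conj_trivial] at hx
          rw [inner_sub_left]; linarith
        rw [← sub_sub, inner_sub_left, this, inner_smul_left, ← hη]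
        simp only [conj_trivial]
        field_simp
        ring)
      have hxe : (w + (τ / η) • a) + edgeMap e y = x := by rw [hy]; abel
      refine ⟨y, ?_, hxe⟩
      have : w + edgeMap e y + (η⁻¹ * τ) • a = x := by
        rw [← hxe, div_eq_inv_mul]; abel
      rwa [this]
    · rintro ⟨y, hy, rfl⟩
      refine ⟨?_, ?_⟩
      · have : w + (τ / η) • a + edgeMap e y = w + edgeMap e y + (η⁻¹ * τ) • a := by
          rw [div_eq_inv_mul]; abel
        rwa [this]
      · have : w + (τ / η) • a + edgeMap e y - (τ • ν + w)
            = (τ / η) • a + edgeMap e y - τ • ν := by abel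
        rw [this, inner_sub_left, inner_add_left, inner_smul_left, inner_smul_left,
          inner_edgeMap h, real_inner_self_eq_norm_sq, hν, ← hη]
        simp only [conj_trivial]
        field_simp
        ring
  -- Lebesgue measure is the integral over `τ` of the surface measures of parallel slices.
  have hvol := EuclideanGeometry.euclideanHausdorffMeasure_eq_lintegral w hν0 hA
  simp only [finrank_euclideanSpace_fin, EuclideanSpace.euclideanHausdorffMeasure_eq_volume,
    Nat.add_sub_cancel] at hvol
  simp_rw [hslice, hausdorff_image_edgeMap] at hvol
  have hmeas : Measurable fun t : ℝ => (volume : Measure (E n)) {y | prismMap e w a (y, t) ∈ A} :=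
    measurable_measure_prodMk_right (hcont.measurable hA)
  rw [hvol, Measure.smul_apply, Measure.map_apply hcont.measurable hA, smul_eq_mul,
    Measure.volume_eq_prod, Measure.prod_apply_symm (hcont.measurable hA),
    lintegral_const_mul _ (show Measurable fun τ : ℝ =>
      (volume : Measure (E n)) {y | prismMap e w a (y, η⁻¹ * τ) ∈ A} from
      hmeas.comp (measurable_const_mul η⁻¹)),
    ENNReal.ofReal_mul (abs_nonneg _)]
  -- The substitution `t = τ / η` produces the factor `|η|`, the height.
  have hscale : ∫⁻ τ : ℝ, (volume : Measure (E n)) {y | prismMap e w a (y, η⁻¹ * τ) ∈ A} =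
      ENNReal.ofReal |η| *
        ∫⁻ t : ℝ, (volume : Measure (E n)) {y | prismMap e w a (y, t) ∈ A} := by
    rw [← lintegral_map hmeas (measurable_const_mul η⁻¹),
      Real.map_volume_mul_left (inv_ne_zero ha), inv_inv, lintegral_smul_measure, smul_eq_mul]
  rw [hscale]
  have : ‖ν‖ₑ = 1 := by rw [← ofReal_norm, hν, ENNReal.ofReal_one]
  rw [this, one_mul, ← mul_assoc, mul_comm (ENNReal.ofReal (edgeMap e).normDet)]
  rfl

/-- Volume integrals in an affine parametrisation. -/
theorem setIntegral_image_prismMap {n : ℕ} {e : Fin n → E (n + 1)} (he : LinearIndependent ℝ e)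
    {ν a : E (n + 1)} (hν : ‖ν‖ = 1) (h : ∀ j, inner ℝ (e j) ν = 0) (ha : inner ℝ a ν ≠ 0)
    (w : E (n + 1)) (s : Set (E n × ℝ)) (g : E (n + 1) → ℝ) :
    ∫ x in prismMap e w a '' s, g x =
      |inner ℝ a ν| * (edgeMap e).normDet * ∫ z in s, g (prismMap e w a z) := by
  have hinj := prismMap_injective he h ha w
  have hemb := (continuous_prismMap e w a).measurableEmbedding hinj
  rw [volume_eq_smul_map_prismMap he hν h ha w, Measure.restrict_smul, integral_smul_measure,
    hemb.setIntegral_map, Set.preimage_image_eq _ hinj, ENNReal.toReal_ofReal, smul_eq_mul]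
  exact mul_nonneg (abs_nonneg _) (LinearMap.normDet_nonneg _)

/-! ### Reference simplices -/

/-- The reference simplex `{y | 0 ≤ yⱼ, ∑ yⱼ ≤ 1}`. -/
def refSimplex (n : ℕ) : Set (E n) := {y | (∀ j, 0 ≤ y j) ∧ ∑ j, y j ≤ 1}

/-- The reference simplex of one dimension more, with the last coordinate split off. -/
def refPrism (n : ℕ) : Set (E n × ℝ) := {z | (∀ j, 0 ≤ z.1 j) ∧ 0 ≤ z.2 ∧ ∑ j, z.1 j + z.2 ≤ 1}

/-- The weight of `w` is the slack `1 - ∑ yᵢ`. -/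
theorem convexHull_insert_range {ι : Type*} [Fintype ι] {V : Type*} [AddCommGroup V] [Module ℝ V]
    (w : V) (v : ι → V) :
    convexHull ℝ (insert w (range v)) =
      {x | ∃ y : ι → ℝ, (∀ i, 0 ≤ y i) ∧ ∑ i, y i ≤ 1 ∧ w + ∑ i, y i • (v i - w) = x} := by
  apply Set.Subset.antisymm
  · refine convexHull_min ?_ ?_
    · rintro x (rfl | ⟨i, rfl⟩)
      · exact ⟨0, by simp, by simp, by simp⟩
      · classical
        refine ⟨Pi.single i 1, fun j => ?_, by simp, ?_⟩
        · by_cases hj : j = i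
          · subst hj; simp
          · simp [hj]
        · simp [Pi.single_apply, ite_smul]
    · rintro _ ⟨y, hy, hy1, rfl⟩ _ ⟨z, hz, hz1, rfl⟩ a b ha hb hab
      refine ⟨fun i => a * y i + b * z i, fun i => ?_, ?_, ?_⟩
      · have := hy i; have := hz i; positivity
      · rw [Finset.sum_add_distrib, ← Finset.mul_sum, ← Finset.mul_sum]
        nlinarith
      · simp only [add_smul, mul_smul, Finset.sum_add_distrib, ← Finset.smul_sum, smul_add]
        have : w = a • w + b • w := by rw [← add_smul, hab, one_smul]
        nth_rewrite 1 [this]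
        abel
  · rintro _ ⟨y, hy, hy1, rfl⟩
    refine mem_convexHull_of_exists_fintype (ι := Option ι)
      (fun o => o.elim (1 - ∑ i, y i) y) (fun o => o.elim w v) ?_ ?_ ?_ ?_
    · rintro (_ | i)
      · simpa using hy1
      · exact hy i
    · simp
    · rintro (_ | i)
      · exact Or.inl rfl
      · exact Or.inr ⟨i, rfl⟩
    · simp only [Fintype.sum_option, Option.elim, smul_sub, Finset.sum_sub_distrib, sub_smul,
        Finset.sum_smul, one_smul]
      abel

theorem convexHull_eq_image_refSimplex {n d : ℕ} (w : E d) (v : Fin n → E d) :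
    convexHull ℝ (insert w (range v)) =
      (fun y => w + edgeMap (fun j => v j - w) y) '' refSimplex n := by
  rw [convexHull_insert_range]
  ext x
  constructor
  · rintro ⟨y, h1, h2, rfl⟩
    exact ⟨WithLp.toLp 2 y, ⟨h1, h2⟩, rfl⟩
  · rintro ⟨y, ⟨h1, h2⟩, rfl⟩
    exact ⟨y, h1, h2, rfl⟩

/-- `Option (Fin n)` indexes the vertices other than `w`, with `none` for the apex `b`, whose weight
becomes the last coordinate. -/
theorem convexHull_eq_image_refPrism {n d : ℕ} (w b : E d) (v : Fin n → E d) :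
    convexHull ℝ (insert w (insert b (range v))) =
      prismMap (fun j => v j - w) w (b - w) '' refPrism n := by
  have hr : insert b (range v) = range (fun o : Option (Fin n) => o.elim b v) := by
    ext x
    simp [Option.exists, eq_comm]
  rw [hr, convexHull_insert_range]
  ext x
  constructor
  · rintro ⟨y, h1, h2, rfl⟩
    refine ⟨(WithLp.toLp 2 fun j => y (some j), y none), ⟨fun j => h1 _, h1 _, ?_⟩, ?_⟩
    · rw [Fintype.sum_option] at h2
      simpa [add_comm] using h2
    · simp only [prismMap, edgeMap_apply, Fintype.sum_option, Option.elim]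
      abel
  · rintro ⟨z, ⟨h1, h2, h3⟩, rfl⟩
    refine ⟨fun o => o.elim z.2 (fun j => z.1 j), ?_, ?_, ?_⟩
    · rintro (_ | j)
      · exact h2
      · exact h1 j
    · rw [Fintype.sum_option, add_comm]
      exact h3
    · simp only [prismMap, edgeMap_apply, Fintype.sum_option, Option.elim]
      abel

theorem isCompact_refSimplex (n : ℕ) : IsCompact (refSimplex n) := by
  have hcl : IsClosed (refSimplex n) := by
    have : refSimplex n = (⋂ j, {y : E n | 0 ≤ y j}) ∩ {y | ∑ j, y j ≤ 1} := by
      ext; simp [refSimplex]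
    rw [this]
    exact (isClosed_iInter fun j => isClosed_le (by fun_prop) (by fun_prop)).inter
      (isClosed_le (by fun_prop) (by fun_prop))
  refine Metric.isCompact_of_isClosed_isBounded hcl ?_
  have hb : Bornology.IsBounded ((EuclideanSpace.equiv (Fin n) ℝ).symm '' Icc 0 1) :=
    (isCompact_Icc.image (EuclideanSpace.equiv (Fin n) ℝ).symm.continuous).isBounded
  refine hb.subset ?_
  rintro y ⟨h0, h1⟩
  refine ⟨y.ofLp, ⟨h0, fun j => ?_⟩, rfl⟩
  exact (Finset.single_le_sum (fun i _ => h0 i) (Finset.mem_univ j)).trans h1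

theorem isClosed_refPrism (n : ℕ) : IsClosed (refPrism n) := by
  have : refPrism n = (⋂ j, {z : E n × ℝ | 0 ≤ z.1 j}) ∩ ({z | 0 ≤ z.2} ∩
      {z | ∑ j, z.1 j + z.2 ≤ 1}) := by
    ext; simp [refPrism]
  rw [this]
  exact (isClosed_iInter fun j => isClosed_le (by fun_prop) (by fun_prop)).inter
    ((isClosed_le (by fun_prop) (by fun_prop)).inter (isClosed_le (by fun_prop) (by fun_prop)))

theorem isCompact_refPrism (n : ℕ) : IsCompact (refPrism n) := by
  refine ((isCompact_refSimplex n).prod (isCompact_Icc (a := (0 : ℝ)) (b := 1))).of_isClosed_subset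
    (isClosed_refPrism n) ?_
  rintro z ⟨h0, h1, h2⟩
  have : 0 ≤ ∑ j, z.1 j := Finset.sum_nonneg fun j _ => h0 j
  exact ⟨⟨h0, by linarith⟩, h1, by linarith⟩

theorem convex_refPrism (n : ℕ) : Convex ℝ (refPrism n) := by
  rintro z ⟨h1, h2, h3⟩ z' ⟨h1', h2', h3'⟩ a b ha hb hab
  refine ⟨fun j => ?_, ?_, ?_⟩
  · have := h1 j; have := h1' j
    simp only [Prod.fst_add, Prod.smul_fst, PiLp.add_apply, PiLp.smul_apply, smul_eq_mul]
    positivity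
  · simp only [Prod.snd_add, Prod.smul_snd, smul_eq_mul]
    positivity
  · simp only [Prod.fst_add, Prod.smul_fst, PiLp.add_apply, PiLp.smul_apply, smul_eq_mul,
      Prod.snd_add, Prod.smul_snd, Finset.sum_add_distrib, ← Finset.mul_sum]
    nlinarith

theorem interior_refPrism_nonempty (n : ℕ) : (interior (refPrism n)).Nonempty := by
  have hopen : IsOpen ((⋂ j, {z : E n × ℝ | 0 < z.1 j}) ∩ ({z | 0 < z.2} ∩
      {z | ∑ j, z.1 j + z.2 < 1})) :=
    (isOpen_iInter_of_finite fun j => isOpen_lt (by fun_prop) (by fun_prop)).inter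
      ((isOpen_lt (by fun_prop) (by fun_prop)).inter (isOpen_lt (by fun_prop) (by fun_prop)))
  have hsub : ((⋂ j, {z : E n × ℝ | 0 < z.1 j}) ∩ ({z | 0 < z.2} ∩
      {z | ∑ j, z.1 j + z.2 < 1})) ⊆ refPrism n := by
    rintro z ⟨h1, h2, h3⟩
    rw [mem_iInter] at h1
    exact ⟨fun j => (h1 j).le, le_of_lt h2, le_of_lt h3⟩
  -- The barycentre, with all coordinates and the slack equal to `1 / (n + 2)`.
  refine ⟨(WithLp.toLp 2 fun _ => 1 / (n + 2 : ℝ), 1 / (n + 2 : ℝ)),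
    interior_maximal hsub hopen ⟨?_, ?_, ?_⟩⟩
  · rw [mem_iInter]
    intro j
    simp only [mem_ofPred_eq]
    positivity
  · simp only [mem_ofPred_eq]
    positivity
  · simp only [mem_ofPred_eq, Finset.sum_const, Finset.card_univ, Fintype.card_fin, nsmul_eq_mul]
    rw [← add_one_mul, ← div_eq_mul_one_div, div_lt_one (by positivity)]
    linarith

/-- Through this inclusion a continuous function that vanishes almost everywhere on the simplex
vanishes everywhere on it, its base included. -/
theorem refPrism_subset_closure_interior (n : ℕ) :
    refPrism n ⊆ closure (interior (refPrism n)) := by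
  rw [(convex_refPrism n).closure_interior_eq_closure_of_nonempty_interior
    (interior_refPrism_nonempty n)]
  exact subset_closure

/-- The volume of the reference simplex is positive. -/
theorem volume_refPrism_pos (n : ℕ) : 0 < ∫ _ in refPrism n, (1 : ℝ) := by
  rw [setIntegral_const, smul_eq_mul, mul_one, measureReal_def]
  exact ENNReal.toReal_pos ((Measure.measure_pos_of_nonempty_interior _
    (interior_refPrism_nonempty n)).ne') (isCompact_refPrism n).measure_ne_top

/-- The fundamental theorem of calculus in the last coordinate of the reference simplex. -/
theorem setIntegral_refPrism_deriv {n : ℕ} {G G' : E n × ℝ → ℝ} (hG : Continuous G')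
    (hd : ∀ y t, HasDerivAt (fun s => G (y, s)) (G' (y, t)) t) :
    ∫ z in refPrism n, G' z =
      ∫ y in refSimplex n, (G (y, 1 - ∑ j, y j) - G (y, 0)) := by
  have hint : IntegrableOn G' (refPrism n) := hG.continuousOn.integrableOn_compact
    (isCompact_refPrism n)
  rw [← integral_indicator (isClosed_refPrism n).measurableSet,
    ← integral_indicator (isCompact_refSimplex n).measurableSet, Measure.volume_eq_prod,
    integral_prod _ (by
      rw [← Measure.volume_eq_prod]
      exact hint.integrable_indicator (isClosed_refPrism n).measurableSet)]
  refine integral_congr_ae (Filter.Eventually.of_forall fun y => ?_)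
  by_cases hy : y ∈ refSimplex n
  · simp only [Set.indicator_of_mem hy]
    have hle : 0 ≤ 1 - ∑ j, y j := by linarith [hy.2]
    -- Over `y` the simplex is the interval from `0` to `1 - ∑ yⱼ`, so Fubini leaves a one-variable
    -- statement.
    have : (fun t => (refPrism n).indicator G' (y, t)) =
        (Icc 0 (1 - ∑ j, y j)).indicator fun t => G' (y, t) := by
      ext t
      by_cases ht : t ∈ Icc 0 (1 - ∑ j, y j)
      · rw [Set.indicator_of_mem ht, Set.indicator_of_mem]
        exact ⟨hy.1, ht.1, by linarith [ht.2]⟩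
      · rw [Set.indicator_of_notMem ht, Set.indicator_of_notMem]
        rintro ⟨-, h1, h2⟩
        exact ht ⟨h1, by dsimp only at h2; linarith⟩
    rw [this, integral_indicator measurableSet_Icc, integral_Icc_eq_integral_Ioc,
      ← intervalIntegral.integral_of_le hle]
    exact intervalIntegral.integral_eq_sub_of_hasDerivAt (fun t _ => hd y t)
      ((hG.comp (by fun_prop : Continuous fun t : ℝ => (y, t))).intervalIntegrable _ _)
  · simp only [Set.indicator_of_notMem hy]
    rw [← integral_zero ℝ ℝ]
    congr 1
    ext t
    rw [Set.indicator_of_notMem]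
    rintro ⟨h0, h1, h2⟩
    exact hy ⟨h0, by dsimp only at h1 h2; linarith⟩

/-! ### Calculus of polynomials -/

@[simp] theorem val_add {d : ℕ} (p q : Poly d) (x : E d) : val (p + q) x = val p x + val q x := by
  simp [val]

@[simp] theorem val_mul {d : ℕ} (p q : Poly d) (x : E d) : val (p * q) x = val p x * val q x := by
  simp [val]

@[simp] theorem val_neg {d : ℕ} (p : Poly d) (x : E d) : val (-p) x = -val p x := by
  simp [val]

@[fun_prop] theorem continuous_val {d : ℕ} (p : Poly d) : Continuous (val p) := by
  unfold val
  exact (MvPolynomial.continuous_eval p).comp (PiLp.continuous_ofLp 2 _)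

/-- The directional derivative of a polynomial. -/
theorem hasDerivAt_val {d : ℕ} (p : Poly d) (x a : E d) (t : ℝ) :
    HasDerivAt (fun s : ℝ => val p (x + s • a)) (grad p (x + t • a) ⬝ᵥ a.ofLp) t := by
  induction p using MvPolynomial.induction_on with
  | C c => simpa [val, grad, dotProduct] using hasDerivAt_const t c
  | add p q hp hq =>
    have := hp.add hq
    convert! this using 1
    · ext s; simp
    · simp [grad, dotProduct, add_mul, Finset.sum_add_distrib]
  | mul_X p i hp =>
    have hX : HasDerivAt (fun s : ℝ => val (MvPolynomial.X i) (x + s • a)) (a i) t := by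
      simpa [val] using ((hasDerivAt_id t).mul_const (a i)).const_add (x i)
    have := hp.mul hX
    convert! this using 1
    · ext s; simp
    · simp only [grad, dotProduct, MvPolynomial.pderiv_mul, val_add, val_mul, add_mul,
        Finset.sum_add_distrib, Finset.sum_mul]
      congr 1
      · exact Finset.sum_congr rfl fun j _ => by ring
      · rw [Finset.sum_eq_single i]
        · simp [val]
        · intro j _ hj
          simp [val, MvPolynomial.pderiv_X_of_ne hj.symm]
        · simp

@[fun_prop] theorem continuous_grad {d : ℕ} (p : Poly d) : Continuous (grad p) := by
  unfold grad
  fun_prop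

/-! ### Integrals over a simplex and its facets -/

/-- A single list `x` of remaining vertices serves the facets opposite `b` and opposite `w`, so that
both can be parametrised by the same `y`. -/
theorem exists_enumeration {n : ℕ} {K : Finset (E (n + 1))}
    (hK : AffineIndependent ℝ ((↑) : K → E (n + 1))) (hcard : K.card = n + 2)
    {w b : E (n + 1)} (hw : w ∈ K) (hb : b ∈ K) (hwb : w ≠ b) :
    ∃ x : Fin n → E (n + 1), LinearIndependent ℝ (fun j => x j - w) ∧
      LinearIndependent ℝ (fun j => x j - b) ∧
      ((K.erase b : Finset (E (n + 1))) : Set (E (n + 1))) = insert w (range x) ∧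
      ((K.erase w : Finset (E (n + 1))) : Set (E (n + 1))) = insert b (range x) := by
  have hc : ((K.erase w).erase b).card = n := by
    rw [Finset.card_erase_of_mem (Finset.mem_erase.2 ⟨hwb.symm, hb⟩),
      Finset.card_erase_of_mem hw, hcard]
    rfl
  let eq := ((K.erase w).erase b).equivFinOfCardEq hc
  have hmem : ∀ j, (eq.symm j : E (n + 1)) ≠ b ∧ (eq.symm j : E (n + 1)) ≠ w ∧
      (eq.symm j : E (n + 1)) ∈ K := fun j => by
    obtain ⟨h1, h2⟩ := Finset.mem_erase.1 (eq.symm j).2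
    exact ⟨h1, Finset.mem_erase.1 h2⟩
  have hrange : range (fun j => (eq.symm j : E (n + 1))) = {z | z ≠ b ∧ z ≠ w ∧ z ∈ K} := by
    ext z
    constructor
    · rintro ⟨j, rfl⟩
      exact hmem j
    · intro hz
      exact ⟨eq ⟨z, by simpa [Finset.mem_erase] using hz⟩, by simp⟩
  have hli : ∀ c (hc : c ∈ K), (∀ j, (eq.symm j : E (n + 1)) ≠ c) →
      LinearIndependent ℝ (fun j => (eq.symm j : E (n + 1)) - c) := by
    intro c hc hne
    have h := (affineIndependent_iff_linearIndependent_vsub ℝ _ (⟨c, hc⟩ : K)).1 hK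
    refine h.comp (fun j => ⟨⟨(eq.symm j : E (n + 1)), (hmem j).2.2⟩, fun h => hne j
      (congrArg Subtype.val h)⟩) ?_
    intro i j hij
    have : (eq.symm i : E (n + 1)) = eq.symm j := congrArg (fun z => (z.1.1 : E (n + 1))) hij
    exact eq.symm.injective (Subtype.ext this)
  refine ⟨fun j => eq.symm j, hli w hw fun j => (hmem j).2.1, hli b hb fun j => (hmem j).1, ?_, ?_⟩
  · rw [hrange]
    ext z
    simp only [Finset.coe_erase, mem_sdiff, Finset.mem_coe, mem_singleton_iff, mem_insert_iff,
      mem_ofPred_eq]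
    by_cases h : z = w
    · subst h; simp [hw, hwb]
    · simp [h, and_comm]
  · rw [hrange]
    ext z
    simp only [Finset.coe_erase, mem_sdiff, Finset.mem_coe, mem_singleton_iff, mem_insert_iff,
      mem_ofPred_eq]
    by_cases h : z = b
    · subst h; simp [hb, hwb.symm]
    · simp [h, and_comm]

theorem isCompact_closedCell {d : ℕ} (s : Finset (E d)) : IsCompact (closedCell s) :=
  s.finite_toSet.isCompact_convexHull (𝕜 := ℝ)

/-- The frontier of a convex set is a null set. -/
theorem cellInt_eq_setIntegral_closedCell {d : ℕ} (K : Finset (E d)) (g : E d → ℝ) :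
    cellInt K g = ∫ x in closedCell K, g x := by
  unfold cellInt openCell
  refine setIntegral_congr_set ?_
  exact interior_ae_eq_of_null_frontier ((convex_convexHull ℝ _).addHaar_frontier volume)

/-- Integrals over a cell and over one of its facets, both in coordinates for which the facet is
the base of the reference simplex. -/
theorem integrals_in_coordinates {n : ℕ} {K : Finset (E (n + 1))} {w b : E (n + 1)}
    (hw : w ∈ K) (hb : b ∈ K) (hwb : w ≠ b) {x : Fin n → E (n + 1)}
    (hx : LinearIndependent ℝ (fun j => x j - w))
    (hF : ((K.erase b : Finset (E (n + 1))) : Set (E (n + 1))) = insert w (range x))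
    {ν : E (n + 1)} (hν : IsOutwardNormal K (K.erase b) ν) :
    (∀ g : E (n + 1) → ℝ, facetInt (K.erase b) g =
      (edgeMap fun j => x j - w).normDet *
        ∫ y in refSimplex n, g (w + edgeMap (fun j => x j - w) y)) ∧
    ∀ g : E (n + 1) → ℝ, cellInt K g =
      inner ℝ (w - b) ν * (edgeMap fun j => x j - w).normDet *
        ∫ z in refPrism n, g (prismMap (fun j => x j - w) w (b - w) z) := by
  have hwF : w ∈ K.erase b := Finset.mem_erase.2 ⟨hwb, hw⟩
  have hxF : ∀ j, x j ∈ K.erase b := fun j => by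
    rw [← Finset.mem_coe, hF]
    exact Or.inr ⟨j, rfl⟩
  have hK : (K : Set (E (n + 1))) = insert w (insert b (range x)) := by
    rw [Set.insert_comm, ← hF, ← Finset.coe_insert, Finset.insert_erase hb]
  have hneg : inner ℝ (b - w) ν < 0 := hν.2.2 w hwF b hb (Finset.notMem_erase b K)
  refine ⟨fun g => ?_, fun g => ?_⟩
  · rw [← setIntegral_hausdorff_image_edgeMap hx, ← convexHull_eq_image_refSimplex, ← hF]
    rfl
  · have h1 := setIntegral_image_prismMap hx hν.1 (fun j => hν.2.1 w hwF _ (hxF j)) hneg.ne w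
      (refPrism n) g
    rw [cellInt_eq_setIntegral_closedCell, closedCell, hK, convexHull_eq_image_refPrism, h1,
      abs_of_neg hneg, ← inner_neg_left, neg_sub]

/-- The slanted face `t = 1 - ∑ yⱼ` is the facet opposite `w`, parametrised from `b` by the same
`y`. -/
theorem apex_formula {n : ℕ} (w b : E (n + 1)) (x : Fin n → E (n + 1)) (y : E n) :
    w + edgeMap (fun j => x j - w) y + (1 - ∑ j, y j) • (b - w) =
      b + edgeMap (fun j => x j - b) y := by
  simp only [edgeMap_apply, smul_sub, Finset.sum_sub_distrib, ← Finset.sum_smul, sub_smul, one_smul]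
  abel

/-- Integration by parts along an edge of a simplex. -/
theorem cellInt_grad_edge {n : ℕ} {K : Finset (E (n + 1))}
    (hK : AffineIndependent ℝ ((↑) : K → E (n + 1))) (hcard : K.card = n + 2)
    {w b : E (n + 1)} (hw : w ∈ K) (hb : b ∈ K) (hwb : w ≠ b) {ν ν' : E (n + 1)}
    (hν : IsOutwardNormal K (K.erase b) ν) (hν' : IsOutwardNormal K (K.erase w) ν')
    (p : Poly (n + 1)) :
    cellInt K (fun z => grad p z ⬝ᵥ (b - w).ofLp) =
      inner ℝ (b - w) ν * facetInt (K.erase b) (val p) +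
        inner ℝ (b - w) ν' * facetInt (K.erase w) (val p) := by
  obtain ⟨x, hx, hx', hF, hF'⟩ := exists_enumeration hK hcard hw hb hwb
  obtain ⟨h1, h2⟩ := integrals_in_coordinates hw hb hwb hx hF hν
  obtain ⟨h1', h2'⟩ := integrals_in_coordinates hb hw hwb.symm hx' hF' hν'
  have hc := continuous_prismMap (fun j => x j - w) w (b - w)
  -- Multiplied by the volume of the reference simplex, both sides are the volume of `K`, computed
  -- over one facet and over the other.
  have hJ : inner ℝ (w - b) ν * (edgeMap fun j => x j - w).normDet =
      inner ℝ (b - w) ν' * (edgeMap fun j => x j - b).normDet := by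
    have h := (h2 fun _ => 1).symm.trans (h2' fun _ => 1)
    exact mul_right_cancel₀ (volume_refPrism_pos n).ne' h
  have hG : Continuous fun z => grad p (prismMap (fun j => x j - w) w (b - w) z) ⬝ᵥ
      (b - w).ofLp := ((continuous_grad p).comp hc).dotProduct continuous_const
  have hd : ∀ (y : E n) (t : ℝ), HasDerivAt
      (fun s => val p (prismMap (fun j => x j - w) w (b - w) (y, s)))
      (grad p (prismMap (fun j => x j - w) w (b - w) (y, t)) ⬝ᵥ (b - w).ofLp) t := fun y t =>
    hasDerivAt_val p (w + edgeMap (fun j => x j - w) y) (b - w) t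
  have hftc := setIntegral_refPrism_deriv
    (G := fun z => val p (prismMap (fun j => x j - w) w (b - w) z)) hG hd
  have he : ∀ v : E (n + 1), Continuous (edgeMap (fun j => x j - v)) := fun v =>
    (edgeMap _).continuous_of_finiteDimensional
  have hint : ∀ v : E (n + 1), IntegrableOn (fun y => val p (v + edgeMap (fun j => x j - v) y))
      (refSimplex n) := fun v => by
    have := he v
    exact ((continuous_val p).comp (continuous_const.add this)).continuousOn.integrableOn_compact
      (isCompact_refSimplex n)
  rw [h2, hftc]
  simp only [prismMap, apex_formula, zero_smul, add_zero]
  rw [integral_sub (hint b) (hint w), mul_sub]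
  nth_rewrite 1 [hJ]
  rw [h1, h1', ← neg_sub b w, inner_neg_left]
  ring

theorem vectorSpan_cell_eq_top {n : ℕ} {K : Finset (E (n + 1))}
    (hK : AffineIndependent ℝ ((↑) : K → E (n + 1))) (hcard : K.card = n + 2) :
    vectorSpan ℝ (K : Set (E (n + 1))) = ⊤ := by
  have := hK.vectorSpan_eq_top_of_card_eq_finrank_add_one (by simp [hcard])
  simpa using this

/-- Integration by parts over a simplex, in any direction. -/
theorem cellInt_grad {n : ℕ} {K : Finset (E (n + 1))}
    (hK : AffineIndependent ℝ ((↑) : K → E (n + 1))) (hcard : K.card = n + 2)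
    {ν : E (n + 1) → E (n + 1)} (hν : ∀ v ∈ K, IsOutwardNormal K (K.erase v) (ν v))
    (p : Poly (n + 1)) (a : E (n + 1)) :
    cellInt K (fun z => grad p z ⬝ᵥ a.ofLp) =
      ∑ v ∈ K, inner ℝ a (ν v) * facetInt (K.erase v) (val p) := by
  have hint : ∀ a : E (n + 1), IntegrableOn (fun z => grad p z ⬝ᵥ a.ofLp) (closedCell K) :=
    fun a => ((continuous_grad p).dotProduct continuous_const).continuousOn.integrableOn_compact
      (isCompact_closedCell K)
  -- The directions for which the formula holds form a subspace, and it contains the edges of `K`,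
  -- which span everything.
  let M : Submodule ℝ (E (n + 1)) :=
    { carrier := {a | cellInt K (fun z => grad p z ⬝ᵥ a.ofLp) =
        ∑ v ∈ K, inner ℝ a (ν v) * facetInt (K.erase v) (val p)}
      zero_mem' := by simp [cellInt]
      add_mem' := by
        intro a b ha hb
        simp only [mem_ofPred_eq, cellInt_eq_setIntegral_closedCell] at ha hb ⊢
        simp only [inner_add_left, add_mul, Finset.sum_add_distrib, ← ha, ← hb]
        rw [← integral_add (hint a) (hint b)]
        simp [dotProduct_add]
      smul_mem' := by
        intro c a ha
        simp only [mem_ofPred_eq, cellInt_eq_setIntegral_closedCell] at ha ⊢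
        simp only [inner_smul_left, conj_trivial, mul_assoc, ← Finset.mul_sum, ← ha]
        rw [← integral_const_mul]
        simp [dotProduct_smul] }
  have htop : M = ⊤ := by
    rw [← top_le_iff, ← vectorSpan_cell_eq_top hK hcard, vectorSpan_def, Submodule.span_le]
    rintro _ ⟨b, hb, w, hw, rfl⟩
    by_cases hwb : w = b
    · subst hwb
      simp
    have hw' : w ∈ K := hw
    have hb' : b ∈ K := hb
    show cellInt K (fun z => grad p z ⬝ᵥ (b - w).ofLp) = _
    -- Every facet other than those opposite `b` and `w` contains the edge, so its normal is
    -- orthogonal to `b - w`.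
    rw [cellInt_grad_edge hK hcard hw hb hwb (hν b hb) (hν w hw),
      ← Finset.sum_subset (s₁ := {b, w}) (by
        intro v hv
        rcases Finset.mem_insert.1 hv with rfl | hv
        · exact hb'
        · rw [Finset.mem_singleton.1 hv]; exact hw'), Finset.sum_pair (Ne.symm hwb)]
    · rfl
    · intro v hv hne
      simp only [Finset.mem_insert, Finset.mem_singleton, not_or] at hne
      have := (hν v hv).2.1 w (Finset.mem_erase.2 ⟨Ne.symm hne.2, hw⟩) b
        (Finset.mem_erase.2 ⟨Ne.symm hne.1, hb⟩)
      show inner ℝ (b - w) (ν v) * _ = 0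
      rw [this, zero_mul]
  have : a ∈ M := htop ▸ Submodule.mem_top
  exact this

/-- The surface measure of a facet is finite. -/
theorem hausdorff_facet_ne_top {n d : ℕ} {F : Finset (E d)} (hF : F.card = n + 1) :
    Measure.euclideanHausdorffMeasure n (closedCell F) ≠ ⊤ := by
  obtain ⟨w, hw⟩ : F.Nonempty := Finset.card_pos.1 (by omega)
  have hc : (F.erase w).card = n := by rw [Finset.card_erase_of_mem hw, hF]; rfl
  let eq := (F.erase w).equivFinOfCardEq hc
  have hFe : (F : Set (E d)) = insert w (range fun j => (eq.symm j : E d)) := by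
    have : range (fun j => (eq.symm j : E d)) = ((F.erase w : Finset (E d)) : Set (E d)) := by
      ext z
      constructor
      · rintro ⟨j, rfl⟩
        exact (eq.symm j).2
      · intro hz
        exact ⟨eq ⟨z, hz⟩, by simp⟩
    rw [this, ← Finset.coe_insert, Finset.insert_erase hw]
  rw [closedCell, hFe, convexHull_eq_image_refSimplex, hausdorff_image_edgeMap]
  exact ENNReal.mul_ne_top ENNReal.ofReal_ne_top (isCompact_refSimplex n).measure_ne_top

theorem integrableOn_facet {n d : ℕ} {F : Finset (E d)} (hF : F.card = n + 1) {g : E d → ℝ}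
    (hg : Continuous g) :
    IntegrableOn g (closedCell F) (Measure.euclideanHausdorffMeasure n) := by
  obtain ⟨C, hC⟩ := (isCompact_closedCell F).exists_bound_of_continuousOn hg.continuousOn
  exact Measure.integrableOn_of_bounded (hausdorff_facet_ne_top hF)
    hg.aestronglyMeasurable (ae_restrict_of_forall_mem (isCompact_closedCell F).measurableSet hC)

theorem integrableOn_cell {d : ℕ} (K : Finset (E d)) {g : E d → ℝ} (hg : Continuous g) :
    IntegrableOn g (openCell K) :=
  (hg.continuousOn.integrableOn_compact (isCompact_closedCell K)).mono_set interior_subset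

/-- A simplex that contains a ball of radius `r` has heights of at least `2 r`. -/
theorem two_mul_le_height {d : ℕ} {K : Finset (E d)} {w b ν : E d} (hw : w ∈ K) (hb : b ∈ K)
    (hwb : w ≠ b) (hν : IsOutwardNormal K (K.erase b) ν) {c : E d} {r : ℝ} (hr : 0 ≤ r)
    (hball : Metric.closedBall c r ⊆ closedCell K) : 2 * r ≤ inner ℝ (w - b) ν := by
  have hwF : w ∈ K.erase b := Finset.mem_erase.2 ⟨hwb, hw⟩
  have hneg : inner ℝ (b - w) ν < 0 := hν.2.2 w hwF b hb (Finset.notMem_erase b K)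
  -- All vertices except `b` lie in the plane of the facet, so `K` lies in the slab between `b` and
  -- that plane.
  have hslab : closedCell K ⊆ {y | inner ℝ y ν ∈ Icc (inner ℝ b ν) (inner ℝ w ν)} := by
    have hlin : IsLinearMap ℝ fun y : E d => (inner ℝ y ν : ℝ) :=
      ⟨fun x y => inner_add_left x y ν, fun c x => by simp [inner_smul_left]⟩
    refine convexHull_min ?_ ((convex_Icc _ _).is_linear_preimage hlin)
    intro v hv
    rw [inner_sub_left] at hneg
    by_cases hvb : v = b
    · subst hvb
      exact ⟨le_rfl, by linarith⟩
    · have := hν.2.1 w hwF v (Finset.mem_erase.2 ⟨hvb, hv⟩)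
      rw [inner_sub_left] at this
      exact ⟨by linarith, by linarith⟩
  have hmem : ∀ s : ℝ, |s| ≤ r → c + s • ν ∈ Metric.closedBall c r := by
    intro s hs
    rw [mem_closedBall_iff_norm, add_sub_cancel_left, norm_smul, hν.1, mul_one]
    exact hs
  -- Both ends of the diameter of the ball in the direction `ν` lie in the slab.
  have h1 := hslab (hball (hmem r (abs_of_nonneg hr).le))
  have h2 := hslab (hball (hmem (-r) (by rw [abs_neg, abs_of_nonneg hr])))
  simp only [mem_ofPred_eq, inner_add_left, inner_smul_left, conj_trivial,
    real_inner_self_eq_norm_sq, hν.1, mem_Icc] at h1 h2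
  rw [inner_sub_left]
  linarith [h1.2, h2.1]

/-! ### The discrete trace inequality -/

/-- `T` factors through the range of `S`, and a linear map on that finite-dimensional space is
bounded. -/
theorem exists_norm_le_of_ker_le {W F G : Type*} [AddCommGroup W] [Module ℝ W]
    [FiniteDimensional ℝ W] [NormedAddCommGroup F] [NormedSpace ℝ F] [NormedAddCommGroup G]
    [NormedSpace ℝ G] (S : W →ₗ[ℝ] F) (T : W →ₗ[ℝ] G) (h : LinearMap.ker S ≤ LinearMap.ker T) :
    ∃ C : ℝ, 0 < C ∧ ∀ w, ‖T w‖ ≤ C * ‖S w‖ := by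
  obtain ⟨R, hR⟩ := S.rangeRestrict.exists_rightInverse_of_surjective S.range_rangeRestrict
  let Q : LinearMap.range S →L[ℝ] G := LinearMap.toContinuousLinearMap (T.comp R)
  refine ⟨‖Q‖ + 1, by positivity, fun w => ?_⟩
  have hw : T w = Q (S.rangeRestrict w) := by
    have h1 : S.rangeRestrict (R (S.rangeRestrict w)) = S.rangeRestrict w :=
      LinearMap.congr_fun hR _
    have h2 : w - R (S.rangeRestrict w) ∈ LinearMap.ker S := by
      rw [LinearMap.mem_ker, map_sub, sub_eq_zero]
      exact (congrArg Subtype.val h1).symm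
    have h3 := h h2
    rw [LinearMap.mem_ker, map_sub, sub_eq_zero] at h3
    exact h3
  calc ‖T w‖ = ‖Q (S.rangeRestrict w)‖ := by rw [hw]
    _ ≤ ‖Q‖ * ‖S.rangeRestrict w‖ := Q.le_opNorm _
    _ ≤ (‖Q‖ + 1) * ‖S w‖ := by
      have : ‖S.rangeRestrict w‖ = ‖S w‖ := rfl
      rw [this]
      gcongr
      linarith

theorem memLp_restrict_of_isCompact {X : Type*} [TopologicalSpace X] [T2Space X]
    [SecondCountableTopology X] [MeasurableSpace X]
    [BorelSpace X] (μ : Measure X) [IsFiniteMeasureOnCompacts μ] {s : Set X} (hs : IsCompact s)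
    {f : X → ℝ} (hf : Continuous f) : MemLp f 2 (μ.restrict s) := by
  obtain ⟨C, hC⟩ := hs.exists_bound_of_continuousOn hf.continuousOn
  have : IsFiniteMeasure (μ.restrict s) := isFiniteMeasure_restrict.2 hs.measure_ne_top
  exact MemLp.of_bound hf.aestronglyMeasurable C (ae_restrict_of_forall_mem hs.measurableSet hC)

/-- The restriction of continuous functions to a compact set, with values in `L²`. -/
def restrictL2 {X : Type*} [TopologicalSpace X] [T2Space X] [SecondCountableTopology X]
    [MeasurableSpace X]
    [BorelSpace X] (μ : Measure X) [IsFiniteMeasureOnCompacts μ] {s : Set X} (hs : IsCompact s) :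
    C(X, ℝ) →ₗ[ℝ] Lp ℝ 2 (μ.restrict s) where
  toFun f := (memLp_restrict_of_isCompact μ hs f.continuous).toLp f
  map_add' _ _ := rfl
  map_smul' _ _ := rfl

theorem norm_restrictL2_sq {X : Type*} [TopologicalSpace X] [T2Space X]
    [SecondCountableTopology X] [MeasurableSpace X]
    [BorelSpace X] (μ : Measure X) [IsFiniteMeasureOnCompacts μ] {s : Set X} (hs : IsCompact s)
    (f : C(X, ℝ)) : ‖restrictL2 μ hs f‖ ^ 2 = ∫ x in s, f x ^ 2 ∂μ := by
  rw [← real_inner_self_eq_norm_sq, L2.inner_def]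
  refine integral_congr_ae ?_
  filter_upwards [(memLp_restrict_of_isCompact μ hs f.continuous).coeFn_toLp] with x hx
  have : (restrictL2 μ hs f) x = f x := hx
  rw [this]
  simp [sq]

/-- Affine functions on `E n × ℝ`. -/
def affineFunctions (n : ℕ) : Submodule ℝ C(E n × ℝ, ℝ) :=
  Submodule.span ℝ (insert 1 (insert ⟨fun z => z.2, by fun_prop⟩
    (range fun j : Fin n => (⟨fun z => z.1 j, by fun_prop⟩ : C(E n × ℝ, ℝ)))))

theorem affineFunctions_fg (n : ℕ) : (affineFunctions n).FG :=
  Submodule.fg_span (((finite_range _).insert _).insert _)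

theorem one_mem_affineFunctions (n : ℕ) : (1 : C(E n × ℝ, ℝ)) ∈ affineFunctions n :=
  Submodule.subset_span (Or.inl rfl)

/-- The powers play the role of polynomials of degree at most `k`; multiplying by the constant `1`,
itself affine, raises the exponent. -/
theorem affineFunctions_pow_mono (n : ℕ) : Monotone fun k => affineFunctions n ^ k := by
  refine monotone_nat_of_le_succ fun k => ?_
  rw [pow_succ]
  intro f hf
  simpa using Submodule.mul_mem_mul hf (one_mem_affineFunctions n)

theorem prismMap_coord_mem {n d : ℕ} (e : Fin n → E d) (w a : E d) (i : Fin d) :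
    (⟨fun z => prismMap e w a z i, by
      have := continuous_prismMap e w a
      fun_prop⟩ : C(E n × ℝ, ℝ)) ∈ affineFunctions n := by
  have h : (⟨fun z => prismMap e w a z i, by
      have := continuous_prismMap e w a
      fun_prop⟩ : C(E n × ℝ, ℝ)) =
      w i • (1 : C(E n × ℝ, ℝ)) +
        ∑ j, e j i • (⟨fun z => z.1 j, by fun_prop⟩ : C(E n × ℝ, ℝ)) +
        a i • (⟨fun z => z.2, by fun_prop⟩ : C(E n × ℝ, ℝ)) := by
    ext z
    simp [prismMap, edgeMap_apply, ContinuousMap.sum_apply, mul_comm]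
  rw [h]
  refine add_mem (add_mem ?_ (sum_mem fun j _ => ?_)) ?_
  · exact Submodule.smul_mem _ _ (one_mem_affineFunctions n)
  · exact Submodule.smul_mem _ _ (Submodule.subset_span (Or.inr (Or.inr ⟨j, rfl⟩)))
  · exact Submodule.smul_mem _ _ (Submodule.subset_span (Or.inr (Or.inl rfl)))

/-- Polynomials of degree at most `k`, in the coordinates of the reference simplex. -/
theorem val_prismMap_mem {n d k : ℕ} (e : Fin n → E d) (w a : E d) {p : Poly d}
    (hp : p.totalDegree ≤ k) :
    (⟨fun z => val p (prismMap e w a z), (continuous_val p).comp (continuous_prismMap e w a)⟩ :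
      C(E n × ℝ, ℝ)) ∈ affineFunctions n ^ k := by
  let c : Fin d → C(E n × ℝ, ℝ) := fun i => ⟨fun z => prismMap e w a z i, by
      have := continuous_prismMap e w a
      fun_prop⟩
  have h : (⟨fun z => val p (prismMap e w a z),
      (continuous_val p).comp (continuous_prismMap e w a)⟩ : C(E n × ℝ, ℝ)) =
      ∑ m ∈ p.support, p.coeff m • ∏ i, c i ^ m i := by
    ext z
    simp [val, MvPolynomial.eval_eq', ContinuousMap.sum_apply, c]
  rw [h]
  refine sum_mem fun m hm => Submodule.smul_mem _ _ ?_
  have hprod : ∀ s : Finset (Fin d), ∏ i ∈ s, c i ^ m i ∈ affineFunctions n ^ (∑ i ∈ s, m i) := by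
    classical
    intro s
    induction s using Finset.induction_on with
    | empty => simp
    | insert i s hi ih =>
      rw [Finset.prod_insert hi, Finset.sum_insert hi, pow_add]
      exact Submodule.mul_mem_mul (Submodule.pow_mem_pow _ (prismMap_coord_mem e w a i) _) ih
  refine affineFunctions_pow_mono n ?_ (hprod Finset.univ)
  have := MvPolynomial.le_totalDegree hm
  rw [Finsupp.sum_fintype _ _ (fun _ => rfl)] at this
  exact this.trans hp

/-- The trace inequality on the reference simplex. -/
theorem exists_trace_refPrism (n k : ℕ) : ∃ C : ℝ, 0 < C ∧ ∀ f ∈ affineFunctions n ^ k,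
    ∫ y in refSimplex n, f (y, 0) ^ 2 ≤ C * ∫ z in refPrism n, f z ^ 2 := by
  let W := affineFunctions n ^ k
  have : FiniteDimensional ℝ W :=
    Module.Finite.iff_fg.2 ((affineFunctions_fg n).pow k)
  let ι : C(E n, E n × ℝ) := ⟨fun y => (y, 0), by fun_prop⟩
  let S := (restrictL2 (volume : Measure (E n × ℝ)) (isCompact_refPrism n)).comp W.subtype
  let tr : C(E n × ℝ, ℝ) →ₗ[ℝ] C(E n, ℝ) :=
    { toFun := fun f => f.comp ι
      map_add' := fun _ _ => rfl
      map_smul' := fun _ _ => rfl }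
  let T := ((restrictL2 (volume : Measure (E n)) (isCompact_refSimplex n)).comp tr).comp W.subtype
  have hS : ∀ f : W, ‖S f‖ ^ 2 = ∫ z in refPrism n, f.1 z ^ 2 := fun f =>
    norm_restrictL2_sq _ (isCompact_refPrism n) f.1
  have hT : ∀ f : W, ‖T f‖ ^ 2 = ∫ y in refSimplex n, f.1 (y, 0) ^ 2 := fun f =>
    norm_restrictL2_sq _ (isCompact_refSimplex n) (tr f.1)
  -- A function with zero `L²` norm on the simplex is zero on all of it, hence also on the base.
  obtain ⟨C, hC, h⟩ := exists_norm_le_of_ker_le S T (by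
    intro f hf
    rw [LinearMap.mem_ker] at hf ⊢
    have hae : f.1 =ᵐ[(volume : Measure (E n × ℝ)).restrict (refPrism n)] (0 : E n × ℝ → ℝ) := by
      have h1 := (memLp_restrict_of_isCompact (volume : Measure (E n × ℝ)) (isCompact_refPrism n)
        f.1.continuous).coeFn_toLp
      have h2 : (memLp_restrict_of_isCompact (volume : Measure (E n × ℝ)) (isCompact_refPrism n)
        f.1.continuous).toLp f.1 = 0 := hf
      rw [h2] at h1
      exact h1.symm.trans (Lp.coeFn_zero _ _ _)
    have heq := Measure.eqOn_of_ae_eq hae f.1.continuous.continuousOn continuousOn_const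
      (refPrism_subset_closure_interior n)
    have hz : ‖T f‖ ^ 2 = 0 := by
      rw [hT]
      refine setIntegral_eq_zero_of_forall_eq_zero fun y hy => ?_
      have : f.1 (y, 0) = 0 := heq (show (y, (0 : ℝ)) ∈ refPrism n from
        ⟨hy.1, le_rfl, by simpa using hy.2⟩)
      rw [this]; simp
    simpa using hz)
  refine ⟨C ^ 2, by positivity, fun f hf => ?_⟩
  rw [← hS ⟨f, hf⟩, ← hT ⟨f, hf⟩, ← mul_pow]
  exact pow_le_pow_left₀ (norm_nonneg _) (h _) 2

/-- The discrete trace inequality on a simplex, with the height as the length scale. -/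
theorem exists_trace_simplex (n k : ℕ) : ∃ C : ℝ, 0 < C ∧ ∀ {K : Finset (E (n + 1))},
    AffineIndependent ℝ ((↑) : K → E (n + 1)) → K.card = n + 2 →
    ∀ {w b : E (n + 1)}, w ∈ K → b ∈ K → w ≠ b → ∀ {ν}, IsOutwardNormal K (K.erase b) ν →
    ∀ p : Poly (n + 1), p.totalDegree ≤ k →
      inner ℝ (w - b) ν * facetInt (K.erase b) (fun x => val p x ^ 2) ≤
        C * cellInt K (fun x => val p x ^ 2) := by
  obtain ⟨C, hC, h⟩ := exists_trace_refPrism n k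
  refine ⟨C, hC, ?_⟩
  intro K hK hcard w b hw hb hwb ν hν p hp
  obtain ⟨x, hx, -, hF, -⟩ := exists_enumeration hK hcard hw hb hwb
  obtain ⟨h1, h2⟩ := integrals_in_coordinates hw hb hwb hx hF hν
  have hneg : inner ℝ (b - w) ν < 0 :=
    hν.2.2 w (Finset.mem_erase.2 ⟨hwb, hw⟩) b hb (Finset.notMem_erase b K)
  have hpos : 0 ≤ inner ℝ (w - b) ν := by
    rw [← neg_sub, inner_neg_left]; linarith
  have hmain := h _ (val_prismMap_mem (fun j => x j - w) w (b - w) hp)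
  simp only [ContinuousMap.coe_mk, prismMap, zero_smul, add_zero] at hmain
  -- The Jacobian of the base is common to both integrals; the cell integral carries the height as
  -- an additional factor.
  rw [h1, h2]
  have := mul_le_mul_of_nonneg_left hmain
    (mul_nonneg hpos (LinearMap.normDet_nonneg (edgeMap fun j => x j - w)))
  simp only [prismMap]
  linarith

/-! ### Combinatorics of the mesh -/

namespace Triangulation

variable {n : ℕ} {Ω : Set (E (n + 1))} (T : Triangulation (n + 1) Ω)

theorem mem_cells {K : Finset (E (n + 1))} :
    K ∈ T.cells ↔ K ∈ T.complex.faces ∧ K.card = n + 2 := by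
  simp [cells]

theorem mem_facetsOf {K F : Finset (E (n + 1))} :
    F ∈ T.facetsOf K ↔ F ∈ T.facets ∧ F ⊆ K := by
  simp [facetsOf]

variable {T}

theorem affineIndependent_cell {K : Finset (E (n + 1))} (hK : K ∈ T.cells) :
    AffineIndependent ℝ ((↑) : K → E (n + 1)) :=
  T.complex.indep (T.mem_cells.1 hK).1

theorem card_cell {K : Finset (E (n + 1))} (hK : K ∈ T.cells) : K.card = n + 2 :=
  (T.mem_cells.1 hK).2

theorem card_facet {F : Finset (E (n + 1))} (hF : F ∈ T.facets) : F.card = n + 1 := by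
  simp only [facets, Finset.mem_filter] at hF
  exact hF.2

theorem exists_eq_erase {K F : Finset (E (n + 1))} (hK : K ∈ T.cells) (hF : F ∈ T.facetsOf K) :
    ∃ v ∈ K, F = K.erase v := by
  obtain ⟨h1, h2⟩ := T.mem_facetsOf.1 hF
  have hc : (K \ F).card = 1 := by
    rw [Finset.card_sdiff_of_subset h2, card_cell hK, card_facet h1]
    omega
  obtain ⟨v, hv⟩ := Finset.card_eq_one.1 hc
  refine ⟨v, (Finset.mem_sdiff.1 (hv ▸ Finset.mem_singleton_self v)).1, ?_⟩
  rw [← Finset.sdiff_singleton_eq_erase, ← hv, Finset.sdiff_sdiff_eq_self h2]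

theorem erase_mem_facetsOf {K : Finset (E (n + 1))} (hK : K ∈ T.cells) {v : E (n + 1)}
    (hv : v ∈ K) : K.erase v ∈ T.facetsOf K := by
  have hc : (K.erase v).card = n + 1 := by
    rw [Finset.card_erase_of_mem hv, card_cell hK]
    rfl
  refine T.mem_facetsOf.2 ⟨?_, Finset.erase_subset _ _⟩
  simp only [facets, Finset.mem_filter, Set.Finite.mem_toFinset]
  exact ⟨T.complex.down_closed (T.mem_cells.1 hK).1 (Finset.erase_subset _ _)
    (Finset.card_pos.1 (by omega)), hc⟩

/-- A facet corresponds to the vertex that it omits. -/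
theorem sum_facetsOf {K : Finset (E (n + 1))} (hK : K ∈ T.cells)
    (f : Finset (E (n + 1)) → ℝ) : ∑ F ∈ T.facetsOf K, f F = ∑ v ∈ K, f (K.erase v) := by
  classical
  have h : T.facetsOf K = K.image fun v => K.erase v := by
    ext F
    rw [Finset.mem_image]
    constructor
    · intro hF
      obtain ⟨v, hv, rfl⟩ := exists_eq_erase hK hF
      exact ⟨v, hv, rfl⟩
    · rintro ⟨v, hv, rfl⟩
      exact erase_mem_facetsOf hK hv
  rw [h, Finset.sum_image]
  intro v hv w hw hvw
  exact Finset.erase_injOn K hv hw hvw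

/-- The chosen unit normal points outwards. -/
theorem isOutwardNormal_normal {K F : Finset (E (n + 1))} (hK : K ∈ T.cells)
    (hF : F ∈ T.facetsOf K) : IsOutwardNormal K F (WithLp.toLp 2 (normal K F)) := by
  have hc := card_facet (T.mem_facetsOf.1 hF).1
  have h := exists_isOutwardNormal (affineIndependent_cell hK)
    (Finset.card_pos.1 (by omega : 0 < F.card)) (T.mem_facetsOf.1 hF).2
    (by rw [card_cell hK, hc])
  have : normal K F = h.choose.ofLp := dif_pos h
  rw [this]
  exact h.choose_spec

theorem normal_dotProduct_self {K F : Finset (E (n + 1))} (hK : K ∈ T.cells)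
    (hF : F ∈ T.facetsOf K) : normal K F ⬝ᵥ normal K F = 1 := by
  have h := (isOutwardNormal_normal hK hF).1
  have h2 : inner ℝ (WithLp.toLp 2 (normal K F)) (WithLp.toLp 2 (normal K F)) = (1 : ℝ) := by
    rw [real_inner_self_eq_norm_sq, h, one_pow]
  rw [PiLp.inner_apply] at h2
  simpa [dotProduct, sq] using h2

/-- Two cells on the same side of a common facet coincide. -/
theorem eq_of_isOutwardNormal {K K' F : Finset (E (n + 1))} (hK : K ∈ T.cells)
    (hK' : K' ∈ T.cells) (hF : F ∈ T.facetsOf K) (hF' : F ∈ T.facetsOf K') {ν : E (n + 1)}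
    (hν : IsOutwardNormal K F ν) (hν' : IsOutwardNormal K' F ν) : K = K' := by
  classical
  -- Otherwise `K` and `K'` add different vertices `v`, `v'` to `F` on the same side, and a common
  -- point off the plane of `F` contradicts conformity.
  by_contra hne
  obtain ⟨v, hv, hFv⟩ := exists_eq_erase hK hF
  obtain ⟨v', hv', hFv'⟩ := exists_eq_erase hK' hF'
  have hvF : v ∉ F := hFv ▸ Finset.notMem_erase v K
  have hvF' : v' ∉ F := hFv' ▸ Finset.notMem_erase v' K'
  have hKi : K = insert v F := by rw [hFv, Finset.insert_erase hv]
  have hKi' : K' = insert v' F := by rw [hFv', Finset.insert_erase hv']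
  have hvv : v ≠ v' := by
    rintro rfl
    exact hne (hKi.trans hKi'.symm)
  have hinter : (K : Set (E (n + 1))) ∩ K' = F := by
    rw [hKi, hKi']
    ext z
    simp only [Finset.coe_insert, mem_inter_iff, mem_insert_iff, Finset.mem_coe]
    constructor
    · rintro ⟨rfl | h, rfl | h'⟩ <;> first | assumption | exact absurd rfl hvv
    · exact fun h => ⟨Or.inr h, Or.inr h⟩
  obtain ⟨f, hf⟩ : F.Nonempty :=
    Finset.card_pos.1 (by rw [card_facet (T.mem_facetsOf.1 hF).1]; omega)
  have hplane : ∀ y ∈ convexHull ℝ (F : Set (E (n + 1))), inner ℝ (y - f) ν = 0 := by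
    have hlin : IsLinearMap ℝ fun y : E (n + 1) => (inner ℝ y ν : ℝ) :=
      ⟨fun x y => inner_add_left x y ν, fun c x => by simp [inner_smul_left]⟩
    have : convexHull ℝ (F : Set (E (n + 1))) ⊆ {y | inner ℝ y ν ∈ ({inner ℝ f ν} : Set ℝ)} := by
      refine convexHull_min ?_ ((convex_singleton _).is_linear_preimage hlin)
      intro y hy
      have := hν.2.1 f hf y hy
      rw [inner_sub_left, sub_eq_zero] at this
      exact this
    intro y hy
    rw [inner_sub_left, sub_eq_zero]
    exact this hy
  let B : AffineBasis K ℝ (E (n + 1)) := ⟨(↑), affineIndependent_cell hK, by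
    rw [(affineIndependent_cell hK).affineSpan_eq_top_iff_card_eq_finrank_add_one]
    simp [card_cell hK]⟩
  have hB : range B = (K : Set (E (n + 1))) := Subtype.range_coe
  let s : Finset K := Finset.univ.filter fun i => (i : E (n + 1)) ∈ F
  have hs : s.Nonempty := ⟨⟨f, (T.mem_facetsOf.1 hF).2 hf⟩, by simp [s, hf]⟩
  -- The centroid of `F` has positive barycentric coordinates at the vertices of `F` and coordinate
  -- zero at `v`.
  set x : E (n + 1) := s.centroid ℝ B with hx
  have hxF : x ∈ convexHull ℝ (F : Set (E (n + 1))) := by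
    rw [hx, Finset.centroid_eq_centerMass _ hs]
    refine Finset.centerMass_mem_convexHull _ (fun i _ => ?_) ?_ (fun i hi => ?_)
    · simp
    · rw [s.sum_centroidWeights_eq_one_of_nonempty ℝ hs]; exact one_pos
    · exact (Finset.mem_filter.1 hi).2
  let iv : K := ⟨v, hv⟩
  -- In the direction `ν` only the coordinate at `v` contributes, and `v'` lies on the same side as
  -- `v`.
  have hcv : 0 < B.coord iv v' := by
    have h1 : inner ℝ (v' - f) ν = B.coord iv v' * inner ℝ (v - f) ν := by
      have h2 : v' - f = ∑ i, B.coord i v' • ((i : E (n + 1)) - f) := by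
        simp only [smul_sub, Finset.sum_sub_distrib, ← Finset.sum_smul, B.sum_coord_apply_eq_one,
          one_smul]
        congr 1
        exact (B.linear_combination_coord_eq_self v').symm
      rw [h2, sum_inner, Finset.sum_eq_single iv]
      · rw [inner_smul_left]; rfl
      · intro i _ hi
        have hiF : (i : E (n + 1)) ∈ F := by
          have h : (i : E (n + 1)) ∈ insert v F := hKi.subset i.2
          rcases Finset.mem_insert.1 h with h | h
          · exact absurd (Subtype.ext h) hi
          · exact h
        rw [inner_smul_left, hν.2.1 f hf _ hiF, mul_zero]
      · simp
    have h3 := hν.2.2 f hf v hv hvF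
    have h4 := hν'.2.2 f hf v' hv' hvF'
    rw [h1] at h4
    by_contra hcon
    push Not at hcon
    nlinarith
  -- Small steps from `x` towards `v'` stay in `K`: the coordinates at `F` stay positive by
  -- continuity, and the one at `v` increases from zero.
  have hev : ∀ᶠ ε : ℝ in nhdsWithin 0 (Ioi 0), AffineMap.lineMap x v' ε ∈
      convexHull ℝ (K : Set (E (n + 1))) := by
    rw [← hB, B.convexHull_eq_nonneg_coord]
    simp only [mem_ofPred_eq]
    rw [Filter.eventually_all]
    intro i
    by_cases hi : (i : E (n + 1)) ∈ F
    · have hpos : 0 < B.coord i x := by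
        rw [hx, B.coord_apply_centroid (Finset.mem_filter.2 ⟨Finset.mem_univ i, hi⟩)]
        exact inv_pos.2 (Nat.cast_pos.2 (Finset.card_pos.2 hs))
      have hcont : Continuous fun ε : ℝ => B.coord i (AffineMap.lineMap x v' ε) :=
        (B.coord i).continuous_of_finiteDimensional.comp AffineMap.lineMap_continuous
      have h0 : 0 < B.coord i (AffineMap.lineMap x v' (0 : ℝ)) := by
        rwa [AffineMap.lineMap_apply_zero]
      exact nhdsWithin_le_nhds ((hcont.tendsto 0).eventually (lt_mem_nhds h0) |>.mono
        fun _ h => h.le)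
    · have hiv : i = iv := by
        have h : (i : E (n + 1)) ∈ insert v F := hKi.subset i.2
        rcases Finset.mem_insert.1 h with h | h
        · exact Subtype.ext h
        · exact absurd h hi
      have hzero : B.coord iv x = 0 := by
        rw [hx]
        exact B.coord_apply_combination_of_notMem (fun h => hvF (Finset.mem_filter.1 h).2)
          (s.sum_centroidWeights_eq_one_of_nonempty ℝ hs)
      filter_upwards [self_mem_nhdsWithin] with ε hε
      rw [hiv, AffineMap.apply_lineMap, hzero, AffineMap.lineMap_apply_module, smul_zero, zero_add,
        smul_eq_mul]
      exact mul_nonneg (le_of_lt hε) hcv.le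
  have hev1 : ∀ᶠ ε : ℝ in nhdsWithin 0 (Ioi 0), ε ≤ 1 :=
    nhdsWithin_le_nhds (eventually_le_nhds one_pos)
  obtain ⟨ε, ⟨hε1, hε2⟩, hε0⟩ := ((hev.and hev1).and self_mem_nhdsWithin).exists
  have hmem' : AffineMap.lineMap x v' ε ∈ convexHull ℝ (K' : Set (E (n + 1))) := by
    refine (convex_convexHull ℝ _).lineMap_mem
      (convexHull_mono (Finset.coe_subset.2 (T.mem_facetsOf.1 hF').2) hxF)
      (subset_convexHull ℝ _ hv') ⟨le_of_lt hε0, hε2⟩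
  -- Conformity puts this common point into the convex hull of `F`, although its height along `ν` is
  -- `ε` times the nonzero height of `v'`.
  have hmem := T.complex.inter_subset_convexHull (T.mem_cells.1 hK).1 (T.mem_cells.1 hK').1
    ⟨hε1, hmem'⟩
  rw [hinter] at hmem
  have h0 := hplane _ hmem
  have hx0 := hplane _ hxF
  have h4 := hν'.2.2 f hf v' hv' hvF'
  have : AffineMap.lineMap x v' ε - f = (1 - ε) • (x - f) + ε • (v' - f) := by
    rw [AffineMap.lineMap_apply_module]
    simp only [smul_sub, sub_smul, one_smul]
    abel
  rw [this, inner_add_left, inner_smul_left, inner_smul_left, hx0] at h0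
  simp only [conj_trivial, mul_zero, zero_add, mul_eq_zero] at h0
  rcases h0 with h | h
  · exact absurd h (ne_of_gt hε0)
  · linarith

/-- Cells that share a facet have opposite normals on it. -/
theorem normal_eq_neg {K K' F : Finset (E (n + 1))} (hK : K ∈ T.cells)
    (hK' : K' ∈ T.cells) (hF : F ∈ T.facetsOf K) (hF' : F ∈ T.facetsOf K') (hne : K ≠ K') :
    normal K F = -normal K' F := by
  have hν := isOutwardNormal_normal hK hF
  have hν' := isOutwardNormal_normal hK' hF'
  set ν : E (n + 1) := WithLp.toLp 2 (normal K F) with hνdef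
  set ν' : E (n + 1) := WithLp.toLp 2 (normal K' F) with hνdef'
  obtain ⟨v, hv, hFv⟩ := exists_eq_erase hK hF
  have hvF : v ∉ F := hFv ▸ Finset.notMem_erase v K
  obtain ⟨f, hf⟩ : F.Nonempty :=
    Finset.card_pos.1 (by rw [card_facet (T.mem_facetsOf.1 hF).1]; omega)
  have hneg := hν.2.2 f hf v hv hvF
  -- With this `c`, the vector `ν' - c • ν` is orthogonal to `v - f`; both normals are orthogonal to
  -- the remaining edges from `f`.
  set c : ℝ := inner ℝ (v - f) ν' / inner ℝ (v - f) ν with hc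
  have horth : ∀ y : E (n + 1), inner ℝ y (ν' - c • ν) = 0 := by
    have hspan := vectorSpan_cell_eq_top (affineIndependent_cell hK) (card_cell hK)
    rw [vectorSpan_eq_span_vsub_set_right ℝ
      (show f ∈ (K : Set (E (n + 1))) from (T.mem_facetsOf.1 hF).2 hf)] at hspan
    intro y
    have hy : y ∈ Submodule.span ℝ ((· -ᵥ f) '' (K : Set (E (n + 1)))) := hspan ▸ Submodule.mem_top
    induction hy using Submodule.span_induction with
    | mem y hy =>
      obtain ⟨z, hz, rfl⟩ := hy
      simp only [vsub_eq_sub, inner_sub_right, inner_smul_right]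
      by_cases hzv : z = v
      · subst hzv
        rw [hc, div_mul_cancel₀ _ hneg.ne, sub_self]
      · have hzF : z ∈ F := hFv ▸ Finset.mem_erase.2 ⟨hzv, hz⟩
        rw [hν.2.1 f hf z hzF, hν'.2.1 f hf z hzF]
        simp
    | zero => simp
    | add x y _ _ hx hy => rw [inner_add_left, hx, hy, add_zero]
    | smul a x _ hx => rw [inner_smul_left, hx, mul_zero]
  have heq : ν' = c • ν := by
    have := horth (ν' - c • ν)
    rw [inner_self_eq_zero, sub_eq_zero] at this
    exact this
  have habs : |c| = 1 := by
    have := hν'.1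
    rw [heq, norm_smul, hν.1, mul_one] at this
    exact this
  -- The case `c = 1` would put both cells on the same side of `F`.
  rcases (abs_eq zero_le_one).1 habs with h1 | h1
  · rw [h1, one_smul] at heq
    exact absurd (eq_of_isOutwardNormal hK hK' hF hF' hν (heq ▸ hν')) hne
  · rw [h1, neg_one_smul] at heq
    have := congrArg WithLp.ofLp heq
    simp only [hνdef, hνdef', WithLp.ofLp_neg] at this
    rw [this, neg_neg]

end Triangulation

/-- Two terms cancel. With three or more, `cᵢ = -cⱼ = cₗ = -cᵢ` makes every term zero, so no bound
on the number of cells at a facet is needed. -/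
theorem sum_eq_zero_of_pairwise_neg {ι : Type*} (s : Finset ι) (c : ι → ℝ)
    (h : ∀ i ∈ s, ∀ j ∈ s, i ≠ j → c i = -c j) (hs : s.card ≠ 1) : ∑ i ∈ s, c i = 0 := by
  classical
  by_cases h2 : s.card = 2
  · obtain ⟨i, j, hij, rfl⟩ := Finset.card_eq_two.1 h2
    rw [Finset.sum_pair hij, h i (by simp) j (by simp) hij, neg_add_cancel]
  · refine Finset.sum_eq_zero fun i hi => ?_
    have hcard : 1 < (s.erase i).card := by
      have := Finset.card_pos.2 ⟨i, hi⟩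
      rw [Finset.card_erase_of_mem hi]
      omega
    obtain ⟨j, hj, l, hl, hjl⟩ := Finset.one_lt_card.1 hcard
    rw [Finset.mem_erase] at hj hl
    have h1 := h i hi j hj.2 hj.1.symm
    have h2 := h i hi l hl.2 hl.1.symm
    have h3 := h j hj.2 l hl.2 hjl
    linarith

/-- Boundary sums of quantities that change sign across interior facets reduce to `∂Ω`. -/
theorem Triangulation.sumBdry_eq_extInt {n : ℕ} {Ω : Set (E (n + 1))}
    (T : Triangulation (n + 1) Ω) (G : Finset (E (n + 1)) → E (n + 1) → Fin (n + 1) → ℝ) :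
    T.sumBdry (fun K F x => G F x ⬝ᵥ normal K F) = T.extInt (fun K F x => G F x ⬝ᵥ normal K F) := by
  classical
  unfold sumBdry extInt exteriorFacetsOf
  rw [← sub_eq_zero, ← Finset.sum_sub_distrib]
  have h1 : ∀ K ∈ T.cells, (∑ F ∈ T.facetsOf K, facetInt F fun x => G F x ⬝ᵥ normal K F) -
      (∑ F ∈ (T.facetsOf K).filter (fun F => (T.cellsAt F).card = 1),
        facetInt F fun x => G F x ⬝ᵥ normal K F) =
      ∑ F ∈ (T.facetsOf K).filter (fun F => ¬ (T.cellsAt F).card = 1),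
        facetInt F fun x => G F x ⬝ᵥ normal K F := fun K _ => by
    rw [sub_eq_iff_eq_add', Finset.sum_filter_add_sum_filter_not]
  -- The sum is rearranged facet by facet, over the cells adjacent to each.
  rw [Finset.sum_congr rfl h1, Finset.sum_comm' (t' := T.facets.filter fun F =>
    ¬ (T.cellsAt F).card = 1) (s' := fun F => T.cellsAt F) (by
      intro K F
      rw [Finset.mem_filter, Finset.mem_filter, mem_facetsOf, cellsAt, Finset.mem_filter]
      tauto)]
  refine Finset.sum_eq_zero fun F hF => ?_
  rw [Finset.mem_filter] at hF
  refine sum_eq_zero_of_pairwise_neg _ _ (fun K hK K' hK' hne => ?_) hF.2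
  simp only [cellsAt, Finset.mem_filter] at hK hK'
  rw [normal_eq_neg hK.1 hK'.1 (T.mem_facetsOf.2 ⟨hF.1, hK.2⟩) (T.mem_facetsOf.2 ⟨hF.1, hK'.2⟩) hne]
  simp only [facetInt, dotProduct_neg, integral_neg]

/-! ### The time derivative of the energy -/

/-- As `glue` is a sum of indicators, linearity suffices; disjointness of the cells plays no role.
-/
theorem Triangulation.domInt_eq_sumCells {d : ℕ} {Ω : Set (E d)} (T : Triangulation d Ω)
    {g : Finset (E d) → E d → ℝ} (hg : ∀ K ∈ T.cells, Continuous (g K)) :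
    T.domInt g = T.sumCells g := by
  have hsub : ∀ K ∈ T.cells, openCell K ⊆ Ω := fun K hK => by
    rw [T.domain_eq]
    refine interior_mono (T.complex.convexHull_subset_space ?_)
    simp only [cells, Finset.mem_filter, Set.Finite.mem_toFinset] at hK
    exact hK.1
  have hmeas : ∀ K : Finset (E d), MeasurableSet (openCell K) := fun K =>
    isOpen_interior.measurableSet
  unfold domInt sumCells glue cellInt
  rw [integral_finsetSum]
  · refine Finset.sum_congr rfl fun K hK => ?_
    rw [setIntegral_indicator (hmeas K), inter_eq_self_of_subset_right (hsub K hK)]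
  · intro K hK
    exact ((integrableOn_cell K (hg K hK)).integrable_indicator (hmeas K)).integrableOn

/-- Expanding the square gives a finite quadratic form in the coefficients with constant Gram
matrix, which avoids differentiation under the integral. -/
theorem hasDerivWithinAt_cellInt_sq {d : ℕ} (K : Finset (E d)) {ι : Type*} (D : Finset ι)
    {φ : ι → E d → ℝ} (hφ : ∀ e, Continuous (φ e)) {c : ι → ℝ → ℝ} {c' : ι → ℝ} {I : Set ℝ}
    {t : ℝ} (hc : ∀ e ∈ D, HasDerivWithinAt (c e) (c' e) I t) :
    HasDerivWithinAt (fun s => cellInt K fun x => (∑ e ∈ D, c e s * φ e x) ^ 2)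
      (cellInt K fun x => 2 * ((∑ e ∈ D, c' e * φ e x) * ∑ e ∈ D, c e t * φ e x)) I t := by
  have hexp : ∀ a b : ι → ℝ, (cellInt K fun x => (∑ e ∈ D, a e * φ e x) * ∑ e ∈ D, b e * φ e x) =
      ∑ e ∈ D, ∑ f ∈ D, a e * b f * cellInt K fun x => φ e x * φ f x := by
    intro a b
    have hi : ∀ e f, IntegrableOn (fun x => a e * b f * (φ e x * φ f x)) (openCell K) :=
      fun e f => integrableOn_cell K (by have := hφ e; have := hφ f; fun_prop)
    simp only [cellInt, Finset.sum_mul_sum]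
    rw [integral_finsetSum _ fun e _ => by
      refine (integrable_finsetSum D fun f _ => hi e f).congr ?_
      exact Filter.Eventually.of_forall fun x => Finset.sum_congr rfl fun f _ => by ring]
    refine Finset.sum_congr rfl fun e _ => ?_
    rw [integral_finsetSum _ fun f _ => (hi e f).congr
      (Filter.Eventually.of_forall fun x => by ring)]
    refine Finset.sum_congr rfl fun f _ => ?_
    rw [← integral_const_mul]
    congr 1
    ext x
    ring
  have h1 : (fun s => cellInt K fun x => (∑ e ∈ D, c e s * φ e x) ^ 2) = fun s =>
      ∑ e ∈ D, ∑ f ∈ D, c e s * c f s * cellInt K fun x => φ e x * φ f x := by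
    ext s
    rw [← hexp (fun e => c e s) fun e => c e s]
    simp only [sq]
  have h2 : (cellInt K fun x => 2 * ((∑ e ∈ D, c' e * φ e x) * ∑ e ∈ D, c e t * φ e x)) =
      ∑ e ∈ D, ∑ f ∈ D, (c' e * c f t + c e t * c' f) * cellInt K fun x => φ e x * φ f x := by
    have h3 := hexp c' fun e => c e t
    have h4 := hexp (fun e => c e t) c'
    simp only [add_mul, Finset.sum_add_distrib]
    rw [← h3, ← h4]
    simp only [cellInt]
    rw [integral_const_mul, two_mul]
    congr 2
    ext x
    ring
  rw [h1, h2]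
  exact HasDerivWithinAt.fun_sum fun e he => HasDerivWithinAt.fun_sum fun f hf =>
    ((hc e he).mul (hc f hf)).mul_const _

/-- The exponents of total degree at most `k`. -/
def exponents (d k : ℕ) : Finset (Fin d →₀ ℕ) :=
  (Finset.range (k + 1)).biUnion fun j => Finset.univ.finsuppAntidiag j

/-- The index set depends on the degree bound alone, so it stays fixed while the polynomial moves in
time. -/
theorem val_eq_sum_exponents {d k : ℕ} {p : Poly d} (hp : p.totalDegree ≤ k) (x : E d) :
    val p x = ∑ e ∈ exponents d k, p.coeff e * val (MvPolynomial.monomial e 1) x := by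
  have hsub : p.support ⊆ exponents d k := fun e he => by
    simp only [exponents, Finset.mem_biUnion, Finset.mem_range, Finset.mem_finsuppAntidiag]
    refine ⟨∑ i, e i, ?_, rfl, Finset.subset_univ _⟩
    have := MvPolynomial.le_totalDegree he
    rw [Finsupp.sum_fintype _ _ (fun _ => rfl)] at this
    omega
  rw [← Finset.sum_subset hsub fun e _ he => by
    rw [MvPolynomial.notMem_support_iff.1 he, zero_mul]]
  simp [val, MvPolynomial.eval_eq']

namespace Scheme

variable {n : ℕ} {Ω : Set (E (n + 1))} {S : Scheme (n + 1) Ω}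

theorem energy_eq_sumCells (S : Scheme (n + 1) Ω) (U : Fields (n + 1)) :
    S.energy U = ∑ K ∈ S.mesh.cells, ∑ i, cellInt K fun x => val (U.u K i) x ^ 2 := by
  have hcont : ∀ K, Continuous fun x => vval (U.u K) x ⬝ᵥ vval (U.u K) x := fun K => by
    simp only [vval, dotProduct]; fun_prop
  rw [energy, S.mesh.domInt_eq_sumCells fun K _ => hcont K]
  refine Finset.sum_congr rfl fun K _ => ?_
  simp only [cellInt, vval, dotProduct]
  rw [integral_finsetSum _ fun i _ => integrableOn_cell K (by fun_prop)]
  simp only [sq]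

/-- The velocity of a solution is differentiable in time at every point, and the derivative is
a polynomial in space. -/
theorem IsSolution.exists_polynomial_deriv {f g : ℝ → E (n + 1) → Fin (n + 1) → ℝ} {I : Set ℝ}
    {U : ℝ → Fields (n + 1)} (h : S.IsSolution f g I U) {t : ℝ} (ht : t ∈ I)
    (hI : UniqueDiffWithinAt ℝ I t) :
    ∃ v : Finset (E (n + 1)) → Fin (n + 1) → Poly (n + 1),
      (∀ K ∈ S.mesh.cells, ∀ i x,
        derivWithin (fun s => val ((U s).u K i) x) I t = val (v K i) x) ∧
      HasDerivWithinAt (fun s => S.energy (U s))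
        (2 * S.mesh.sumCells fun K x => vval (v K) x ⬝ᵥ vval ((U t).u K) x) I t := by
  let c' : Finset (E (n + 1)) → Fin (n + 1) → (Fin (n + 1) →₀ ℕ) → ℝ := fun K i e =>
    derivWithin (fun s => MvPolynomial.coeff e ((U s).u K i)) I t
  have hc : ∀ K ∈ S.mesh.cells, ∀ i e, HasDerivWithinAt
      (fun s => MvPolynomial.coeff e ((U s).u K i)) (c' K i e) I t := fun K hK i e =>
    (h.diff K hK i e t ht).hasDerivWithinAt
  let D := exponents (n + 1) S.k
  let φ : (Fin (n + 1) →₀ ℕ) → E (n + 1) → ℝ := fun e => val (MvPolynomial.monomial e 1)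
  have hφ : ∀ e, Continuous (φ e) := fun e => continuous_val _
  have hval : ∀ K ∈ S.mesh.cells, ∀ i, ∀ s ∈ I, ∀ x, val ((U s).u K i) x =
      ∑ e ∈ D, MvPolynomial.coeff e ((U s).u K i) * φ e x := fun K hK i s hs x =>
    val_eq_sum_exponents ((h.mem s hs).1 K hK i) x
  -- The coefficients of `v` are the time derivatives of those of `u`.
  let v : Finset (E (n + 1)) → Fin (n + 1) → Poly (n + 1) := fun K i =>
    ∑ e ∈ D, MvPolynomial.C (c' K i e) * MvPolynomial.monomial e 1
  have hv : ∀ K i x, val (v K i) x = ∑ e ∈ D, c' K i e * φ e x := fun K i x => by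
    simp [v, val, φ]
  refine ⟨v, fun K hK i x => ?_, ?_⟩
  · rw [hv]
    refine HasDerivWithinAt.derivWithin ?_ hI
    refine HasDerivWithinAt.congr ?_ (fun s hs => hval K hK i s hs x) (hval K hK i t ht x)
    exact HasDerivWithinAt.fun_sum fun e _ => (hc K hK i e).mul_const _
  · have hE : ∀ s, S.energy (U s) =
        ∑ K ∈ S.mesh.cells, ∑ i, cellInt K fun x => val ((U s).u K i) x ^ 2 :=
      fun s => S.energy_eq_sumCells (U s)
    simp only [hE]
    have hD : 2 * S.mesh.sumCells (fun K x => vval (v K) x ⬝ᵥ vval ((U t).u K) x) =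
        ∑ K ∈ S.mesh.cells, ∑ i, cellInt K fun x => 2 * (val (v K i) x * val ((U t).u K i) x) := by
      rw [Triangulation.sumCells, Finset.mul_sum]
      refine Finset.sum_congr rfl fun K _ => ?_
      simp only [cellInt, vval, dotProduct]
      rw [integral_finsetSum _ fun i _ => integrableOn_cell K (by fun_prop), Finset.mul_sum]
      refine Finset.sum_congr rfl fun i _ => ?_
      rw [← integral_const_mul]
    rw [hD]
    refine HasDerivWithinAt.fun_sum fun K hK => HasDerivWithinAt.fun_sum fun i _ => ?_
    have := hasDerivWithinAt_cellInt_sq K D hφ fun e _ => hc K hK i e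
    -- The expansion holds for times in `I` only, which is enough for a derivative within `I`.
    have heq : ∀ s ∈ I, (cellInt K fun x => val ((U s).u K i) x ^ 2) = cellInt K fun x =>
        (∑ e ∈ D, MvPolynomial.coeff e ((U s).u K i) * φ e x) ^ 2 := fun s hs => by
      simp only [hval K hK i s hs]
    refine (this.congr heq (heq t ht)).congr_deriv ?_
    simp only [hv, hval K hK i t ht]

end Scheme

/-! ### Continuity of the integrands and the upwind switch -/

@[fun_prop] theorem continuous_vval {d : ℕ} (u : Fin d → Poly d) : Continuous (vval u) := by
  unfold vval
  fun_prop

theorem continuous_symGrad_apply {d : ℕ} (u : Fin d → Poly d) (i j : Fin d) :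
    Continuous fun x => symGrad u x i j := by
  simp only [symGrad, vgrad, Matrix.smul_apply, Matrix.add_apply, Matrix.transpose_apply,
    Matrix.of_apply]
  fun_prop

@[fun_prop] theorem continuous_symGrad {d : ℕ} (u : Fin d → Poly d) : Continuous (symGrad u) :=
  continuous_matrix fun i j => continuous_symGrad_apply u i j

@[fun_prop] theorem continuous_vgrad {d : ℕ} (u : Fin d → Poly d) : Continuous (vgrad u) :=
  continuous_matrix fun _ _ => continuous_val _

@[fun_prop] theorem continuous_dotProduct {X : Type*} [TopologicalSpace X] {d : ℕ}
    {f g : X → Fin d → ℝ} (hf : Continuous f) (hg : Continuous g) :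
    Continuous fun x => f x ⬝ᵥ g x := hf.dotProduct hg

@[fun_prop] theorem continuous_mulVec {X : Type*} [TopologicalSpace X] {d : ℕ}
    {A : X → Matrix (Fin d) (Fin d) ℝ} {g : X → Fin d → ℝ} (hA : Continuous A)
    (hg : Continuous g) : Continuous fun x => A x *ᵥ g x := hA.matrix_mulVec hg

@[fun_prop] theorem continuous_frob {X : Type*} [TopologicalSpace X] {d : ℕ}
    {A B : X → Matrix (Fin d) (Fin d) ℝ} (hA : Continuous A) (hB : Continuous B) :
    Continuous fun x => frob (A x) (B x) := by
  unfold frob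
  refine continuous_finsetSum _ fun i _ => continuous_finsetSum _ fun j _ => ?_
  exact (hA.matrix_elem i j).mul (hB.matrix_elem i j)

@[fun_prop] theorem continuous_jump {d : ℕ} (U : Fields d) (K F : Finset (E d)) :
    Continuous (Scheme.jump U K F) := by
  unfold Scheme.jump
  fun_prop

/-- The switch jumps where the flux changes sign, but its product with the flux is continuous;
integrability on facets rests on this. -/
theorem upwind_mul_self (s : ℝ) : Scheme.upwind s * s = min s 0 := by
  unfold Scheme.upwind
  split_ifs with h
  · rw [min_eq_left h.le, one_mul]
  · rw [min_eq_right (not_lt.1 h), zero_mul]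

/-- The quantity equals `|s| / 2`. -/
theorem half_sub_upwind_mul_nonneg (s : ℝ) : 0 ≤ (1 / 2 - Scheme.upwind s) * s := by
  unfold Scheme.upwind
  split_ifs with h
  · linarith
  · push Not at h
    linarith


theorem totalDegree_pderiv_le {d : ℕ} (p : Poly d) (i : Fin d) :
    (MvPolynomial.pderiv i p).totalDegree ≤ p.totalDegree := by
  have h : MvPolynomial.pderiv i p =
      ∑ m ∈ p.support, MvPolynomial.monomial (m - Finsupp.single i 1) (p.coeff m * m i) := by
    conv_lhs => rw [p.as_sum]
    rw [map_sum]
    simp only [MvPolynomial.pderiv_monomial]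
  rw [h]
  refine MvPolynomial.totalDegree_finsetSum_le fun m hm => ?_
  refine (MvPolynomial.totalDegree_monomial_le _ _).trans ?_
  refine le_trans ?_ (MvPolynomial.le_totalDegree hm)
  rw [Finsupp.sum_fintype _ _ (fun _ => rfl), Finsupp.sum_fintype _ _ (fun _ => rfl)]
  exact Finset.sum_le_sum fun j _ => by simp

/-! ### Algebra of the integrands -/

/-- The skew part of the gradient is orthogonal to symmetric matrices. -/
theorem frob_symGrad_vgrad {d : ℕ} (u : Fin d → Poly d) (x : E d) :
    frob (symGrad u x) (vgrad u x) = frob (symGrad u x) (symGrad u x) := by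
  have hswap : frob (symGrad u x) (vgrad u x)ᵀ = frob (symGrad u x) (vgrad u x) := by
    unfold frob
    rw [Finset.sum_comm]
    refine Finset.sum_congr rfl fun i _ => Finset.sum_congr rfl fun j _ => ?_
    simp only [symGrad, Matrix.smul_apply, Matrix.add_apply, Matrix.transpose_apply]
    rw [add_comm]
  have hlin : frob (symGrad u x) (symGrad u x) =
      2⁻¹ * (frob (symGrad u x) (vgrad u x) + frob (symGrad u x) (vgrad u x)ᵀ) := by
    unfold frob
    rw [← Finset.sum_add_distrib, Finset.mul_sum]
    refine Finset.sum_congr rfl fun i _ => ?_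
    rw [← Finset.sum_add_distrib, Finset.mul_sum]
    refine Finset.sum_congr rfl fun j _ => ?_
    have : symGrad u x i j = 2⁻¹ * (vgrad u x i j + (vgrad u x)ᵀ i j) := rfl
    rw [this]
    ring
  rw [hlin, hswap]
  ring

theorem frob_sigma_vgrad {d : ℕ} {Ω : Set (E d)} (S : Scheme d Ω) (U : Fields d)
    (K : Finset (E d)) (x : E d) :
    frob (S.sigma U K x) (vgrad (U.u K) x) =
      (∑ i, val (U.p K) x * vgrad (U.u K) x i i)
        - 2 * S.ν * frob (symGrad (U.u K) x) (symGrad (U.u K) x) := by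
  rw [← frob_symGrad_vgrad]
  simp only [frob, Scheme.sigma, Matrix.sub_apply, Matrix.smul_apply, Matrix.one_apply,
    smul_eq_mul, sub_mul, Finset.sum_sub_distrib, Finset.mul_sum]
  congr 1
  · refine Finset.sum_congr rfl fun i _ => ?_
    simp
  · refine Finset.sum_congr rfl fun i _ => Finset.sum_congr rfl fun j _ => by ring

/-- It identifies the two convective cell terms tested with `u`, whose weights are opposite for `χ =
1/2`. -/
theorem frob_vecMulVec_self {d : ℕ} (u : Fin d → ℝ) (A : Matrix (Fin d) (Fin d) ℝ) :
    frob (Matrix.vecMulVec u u) A = (A *ᵥ u) ⬝ᵥ u := by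
  simp only [frob, Matrix.vecMulVec_apply, Matrix.mulVec, dotProduct, Finset.sum_mul]
  exact Finset.sum_congr rfl fun i _ => Finset.sum_congr rfl fun j _ => by ring

/-- Cauchy–Schwarz in each row. -/
theorem mulVec_dotProduct_self_le {d : ℕ} (A : Matrix (Fin d) (Fin d) ℝ) {n : Fin d → ℝ}
    (hn : n ⬝ᵥ n = 1) : (A *ᵥ n) ⬝ᵥ (A *ᵥ n) ≤ frob A A := by
  refine Finset.sum_le_sum fun i _ => ?_
  have := Finset.sum_mul_sq_le_sq_mul_sq Finset.univ (A i) n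
  have h1 : ∑ j, n j ^ 2 = 1 := by
    rw [← hn]
    simp only [dotProduct, sq]
  rw [h1, mul_one] at this
  calc (A *ᵥ n) i * (A *ᵥ n) i = (∑ j, A i j * n j) ^ 2 := by rw [sq]; rfl
    _ ≤ ∑ j, A i j ^ 2 := this
    _ = ∑ j, A i j * A i j := by simp only [sq]

/-- Young's inequality for the consistency and penalty terms. -/
theorem neg_frob_le_penalty {d : ℕ} (A : Matrix (Fin d) (Fin d) ℝ) {n : Fin d → ℝ}
    (hn : n ⬝ᵥ n = 1) (j : Fin d → ℝ) {ν α h : ℝ} (hν : 0 ≤ ν) (hα : 0 < α) (hh : 0 < h) :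
    -(2 * ν * (h / α) * frob A A) ≤
      4 * ν * (j ⬝ᵥ (A *ᵥ n)) + 2 * ν * (α / h) * (j ⬝ᵥ j) := by
  have h1 := mulVec_dotProduct_self_le A hn
  set s := A *ᵥ n with hs
  -- The claim is the nonnegativity of `|(α / h) j + A n|²`, multiplied by `2 ν h / α`.
  have h2 : 0 ≤ ((α / h) • j + s) ⬝ᵥ ((α / h) • j + s) :=
    Finset.sum_nonneg fun i _ => mul_self_nonneg _
  have h3 : ((α / h) • j + s) ⬝ᵥ ((α / h) • j + s) =
      (α / h) ^ 2 * (j ⬝ᵥ j) + 2 * (α / h) * (j ⬝ᵥ s) + s ⬝ᵥ s := by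
    simp only [add_dotProduct, dotProduct_add, smul_dotProduct, dotProduct_smul, smul_eq_mul,
      dotProduct_comm s j]
    ring
  rw [h3] at h2
  have h4 : 0 ≤ 2 * ν * (h / α) := by positivity
  have h5 := mul_le_mul_of_nonneg_left h1 h4
  have h6 := mul_nonneg h4 h2
  have h7 : 2 * ν * (h / α) * ((α / h) ^ 2 * (j ⬝ᵥ j) + 2 * (α / h) * (j ⬝ᵥ s) + s ⬝ᵥ s) =
      2 * ν * (α / h) * (j ⬝ᵥ j) + 4 * ν * (j ⬝ᵥ s) + 2 * ν * (h / α) * (s ⬝ᵥ s) := by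
    field_simp
    ring
  linarith

namespace Scheme

variable {d : ℕ} {Ω : Set (E d)} (S : Scheme d Ω) (U : Fields d) (K F : Finset (E d)) (x : E d)

theorem flux_eq (hn : normal K F ⬝ᵥ normal K F = 1) : S.flux U K F x =
    vval (U.u K) x ⬝ᵥ normal K F -
      S.β * S.hF F / (S.ν + 1) * (val (U.pb F) x - val (U.p K) x) := by
  rw [flux, uHat, sub_dotProduct, smul_dotProduct, hn, smul_eq_mul, mul_one]

theorem sigmaHat_mulVec_dotProduct (hn : normal K F ⬝ᵥ normal K F = 1) (w : Fin d → ℝ) :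
    (S.sigmaHat U K F x *ᵥ normal K F) ⬝ᵥ w =
      val (U.pb F) x * (w ⬝ᵥ normal K F) - 2 * S.ν * (w ⬝ᵥ (symGrad (U.u K) x *ᵥ normal K F)) -
        S.α / S.hF F * (2 * S.ν) * (jump U K F x ⬝ᵥ w) := by
  rw [sigmaHat, Matrix.sub_mulVec, Matrix.sub_mulVec, Matrix.smul_mulVec, Matrix.smul_mulVec,
    Matrix.smul_mulVec, Matrix.one_mulVec, Matrix.vecMulVec_mulVec, hn, sub_dotProduct,
    sub_dotProduct, smul_dotProduct, smul_dotProduct, smul_dotProduct]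
  simp [dotProduct_comm w]

@[fun_prop] theorem continuous_flux : Continuous (S.flux U K F) := by
  unfold flux uHat
  fun_prop

@[fun_prop] theorem continuous_sigmaHat : Continuous (S.sigmaHat U K F) := by
  unfold sigmaHat
  refine continuous_matrix fun i j => ?_
  have := continuous_symGrad_apply (U.u K) i j
  simp only [Matrix.sub_apply, Matrix.smul_apply, Matrix.vecMulVec_apply]
  fun_prop

@[fun_prop] theorem continuous_upwind_flux :
    Continuous fun x => upwind (S.flux U K F x) * S.flux U K F x := by
  simp only [upwind_mul_self]
  fun_prop

end Scheme

/-! ### Sums of integrals -/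

theorem facetInt_sum {n : ℕ} {F : Finset (E (n + 1))} (hF : F.card = n + 1) {ι : Type*}
    (s : Finset ι) {G : ι → E (n + 1) → ℝ} (hG : ∀ i, Continuous (G i)) :
    facetInt F (fun x => ∑ i ∈ s, G i x) = ∑ i ∈ s, facetInt F (G i) :=
  integral_finsetSum _ fun i _ => integrableOn_facet hF (hG i)

theorem facetInt_const_mul {d : ℕ} (F : Finset (E d)) (c : ℝ) (g : E d → ℝ) :
    facetInt F (fun x => c * g x) = c * facetInt F g :=
  integral_const_mul _ _

namespace Triangulation

variable {n : ℕ} {Ω : Set (E (n + 1))} (T : Triangulation (n + 1) Ω)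

theorem sumBdry_congr {G H : Finset (E (n + 1)) → Finset (E (n + 1)) → E (n + 1) → ℝ}
    (h : ∀ K ∈ T.cells, ∀ F ∈ T.facetsOf K, ∀ x, G K F x = H K F x) :
    T.sumBdry G = T.sumBdry H := by
  refine Finset.sum_congr rfl fun K hK => Finset.sum_congr rfl fun F hF => ?_
  unfold facetInt
  congr 1
  ext x
  exact h K hK F hF x

theorem sum_mul_sumBdry {m : ℕ} (c : Fin m → ℝ)
    (G : Fin m → Finset (E (n + 1)) → Finset (E (n + 1)) → E (n + 1) → ℝ)
    (hG : ∀ j K F, Continuous (G j K F)) :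
    ∑ j, c j * T.sumBdry (G j) = T.sumBdry fun K F x => ∑ j, c j * G j K F x := by
  unfold sumBdry
  simp only [Finset.mul_sum]
  rw [Finset.sum_comm]
  refine Finset.sum_congr rfl fun K _ => ?_
  rw [Finset.sum_comm]
  refine Finset.sum_congr rfl fun F hF => ?_
  have hc := card_facet (T.mem_facetsOf.1 hF).1
  rw [facetInt_sum hc Finset.univ (G := fun j x => c j * G j K F x)
    fun j => continuous_const.mul (hG j K F)]
  exact Finset.sum_congr rfl fun j _ => (facetInt_const_mul _ _ _).symm

theorem domInt_congr {g g' : Finset (E (n + 1)) → E (n + 1) → ℝ}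
    (h : ∀ K ∈ T.cells, ∀ x, g K x = g' K x) : T.domInt g = T.domInt g' := by
  unfold domInt glue
  congr 1
  ext x
  refine Finset.sum_congr rfl fun K hK => ?_
  congr 1
  ext y
  exact h K hK y

/-- Integration by parts on every cell, for a pressure gradient tested with the velocity. -/
theorem sumCells_div_add_grad (U : Fields (n + 1)) :
    T.sumCells (fun K x => (∑ i, val (U.p K) x * vgrad (U.u K) x i i) +
      vval (U.u K) x ⬝ᵥ grad (U.p K) x) =
    T.sumBdry fun K F x => val (U.p K) x * (vval (U.u K) x ⬝ᵥ normal K F) := by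
  refine Finset.sum_congr rfl fun K hK => ?_
  rw [sum_facetsOf hK]
  have hν : ∀ v ∈ K, IsOutwardNormal K (K.erase v) (WithLp.toLp 2 (normal K (K.erase v))) :=
    fun v hv => isOutwardNormal_normal hK (erase_mem_facetsOf hK hv)
  -- The divergence theorem for `p u` is the sum over `i` of the formula for `uᵢ p` in the direction
  -- `eᵢ`.
  have hibp := fun i => cellInt_grad (affineIndependent_cell hK) (card_cell hK) hν
    (U.u K i * U.p K) (EuclideanSpace.single i 1)
  have h1 : (cellInt K fun x => (∑ i, val (U.p K) x * vgrad (U.u K) x i i) +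
      vval (U.u K) x ⬝ᵥ grad (U.p K) x) = ∑ i, cellInt K fun x =>
        grad (U.u K i * U.p K) x ⬝ᵥ (EuclideanSpace.single i (1 : ℝ)).ofLp := by
    simp only [cellInt]
    rw [← integral_finsetSum _ fun i _ => integrableOn_cell K (by fun_prop)]
    congr 1
    ext x
    simp only [dotProduct, ← Finset.sum_add_distrib]
    refine Finset.sum_congr rfl fun i _ => ?_
    rw [Finset.sum_eq_single i (fun j _ hj => by simp [hj]) (by simp)]
    simp only [grad, MvPolynomial.pderiv_mul, val_add, val_mul, vgrad, vval, Matrix.of_apply,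
      PiLp.single_apply, if_true, mul_one]
    ring
  rw [h1, Finset.sum_congr rfl fun i _ => hibp i, Finset.sum_comm]
  refine Finset.sum_congr rfl fun v hv => ?_
  have hc := card_facet (T.mem_facetsOf.1 (erase_mem_facetsOf hK hv)).1
  simp only [← facetInt_const_mul]
  rw [← facetInt_sum hc Finset.univ fun i => by fun_prop]
  congr 1
  ext x
  simp only [dotProduct, Finset.mul_sum, val_mul, vval]
  refine Finset.sum_congr rfl fun i _ => ?_
  rw [EuclideanSpace.inner_single_left]
  simp only [map_one, one_mul]
  ring

end Triangulation

/-! ### Coercivity of the viscous terms -/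

/-- The tensor version of the discrete trace inequality on regular meshes. -/
theorem exists_trace_symGrad (n k : ℕ) {σ : ℝ} (hσ : 1 ≤ σ) : ∃ C : ℝ, 0 < C ∧
    ∀ {Ω : Set (E (n + 1))} (T : Triangulation (n + 1) Ω) {h : Finset (E (n + 1)) → ℝ},
      T.IsRegular h σ → ∀ K ∈ T.cells, ∀ u : Fin (n + 1) → Poly (n + 1),
      (∀ i, (u i).totalDegree ≤ k) →
      ∑ F ∈ T.facetsOf K, T.facetSize h F * facetInt F (fun x => frob (symGrad u x) (symGrad u x)) ≤
        C * cellInt K fun x => frob (symGrad u x) (symGrad u x) := by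
  obtain ⟨C, hC, htr⟩ := exists_trace_simplex n k
  -- There are `n + 2` facets. One factor `σ` compares `facetSize` with `h K`, the other compares `h
  -- K` with the radius of the ball in `K`.
  refine ⟨(n + 2) * (σ ^ 2 * C), by positivity, ?_⟩
  intro Ω T h hT K hK u hu
  obtain ⟨c, r, hball, hr⟩ := hT.2.1 K hK
  have hh := hT.1 K hK
  have hr0 : 0 < r := by
    by_contra hcon
    push Not at hcon
    nlinarith
  -- The entries of the symmetric gradient as polynomials, for use of the scalar trace inequality
  -- entry by entry.
  let q : Fin (n + 1) → Fin (n + 1) → Poly (n + 1) := fun i j =>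
    MvPolynomial.C 2⁻¹ * (MvPolynomial.pderiv j (u i) + MvPolynomial.pderiv i (u j))
  have hq : ∀ i j x, symGrad u x i j = val (q i j) x := fun i j x => by
    simp [q, symGrad, vgrad, val]
  have hqd : ∀ i j, (q i j).totalDegree ≤ k := fun i j => by
    refine (MvPolynomial.totalDegree_mul _ _).trans ?_
    rw [MvPolynomial.totalDegree_C, zero_add]
    refine (MvPolynomial.totalDegree_add _ _).trans (max_le ?_ ?_)
    · exact (totalDegree_pderiv_le _ _).trans (hu i)
    · exact (totalDegree_pderiv_le _ _).trans (hu j)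
  have hfrob : ∀ x, frob (symGrad u x) (symGrad u x) = ∑ i, ∑ j, val (q i j) x ^ 2 := fun x => by
    simp only [frob, hq, sq]
  simp only [hfrob]
  have hcell : (cellInt K fun x => ∑ i, ∑ j, val (q i j) x ^ 2) =
      ∑ i, ∑ j, cellInt K fun x => val (q i j) x ^ 2 := by
    simp only [cellInt]
    rw [integral_finsetSum _ fun i _ => integrableOn_cell K (by fun_prop)]
    refine Finset.sum_congr rfl fun i _ => ?_
    rw [integral_finsetSum _ fun j _ => integrableOn_cell K (by fun_prop)]
  have hbound : ∀ F ∈ T.facetsOf K,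
      T.facetSize h F * facetInt F (fun x => ∑ i, ∑ j, val (q i j) x ^ 2) ≤
        σ ^ 2 * C * cellInt K fun x => ∑ i, ∑ j, val (q i j) x ^ 2 := by
    intro F hF
    have hFT := (T.mem_facetsOf.1 hF).1
    have hcF := Triangulation.card_facet hFT
    have hKF : K ∈ T.cellsAt F := by
      simp only [Triangulation.cellsAt, Finset.mem_filter]
      exact ⟨hK, (T.mem_facetsOf.1 hF).2⟩
    have hsize : T.facetSize h F ≤ σ * h K := by
      have hpos : 0 < ((T.cellsAt F).card : ℝ) := Nat.cast_pos.2 (Finset.card_pos.2 ⟨K, hKF⟩)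
      rw [Triangulation.facetSize, div_le_iff₀ hpos, mul_comm, ← nsmul_eq_mul]
      exact Finset.sum_le_card_nsmul _ _ _ fun K' hK' => hT.2.2 F hFT K' hK' K hKF
    obtain ⟨b, hb, rfl⟩ := Triangulation.exists_eq_erase hK hF
    obtain ⟨w, hw⟩ : (K.erase b).Nonempty := Finset.card_pos.1 (by omega)
    obtain ⟨hwb, hwK⟩ := Finset.mem_erase.1 hw
    have hν := Triangulation.isOutwardNormal_normal hK hF
    have hη := two_mul_le_height hwK hb hwb hν hr0.le hball
    have hsplit : facetInt (K.erase b) (fun x => ∑ i, ∑ j, val (q i j) x ^ 2) =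
        ∑ i, ∑ j, facetInt (K.erase b) fun x => val (q i j) x ^ 2 := by
      rw [facetInt_sum hcF Finset.univ fun i => by fun_prop]
      exact Finset.sum_congr rfl fun i _ => facetInt_sum hcF Finset.univ fun j => by fun_prop
    rw [hsplit, hcell, Finset.mul_sum, Finset.mul_sum]
    refine Finset.sum_le_sum fun i _ => ?_
    rw [Finset.mul_sum, Finset.mul_sum]
    refine Finset.sum_le_sum fun j _ => ?_
    have h1 := htr (Triangulation.affineIndependent_cell hK) (Triangulation.card_cell hK)
      hwK hb hwb hν (q i j) (hqd i j)
    have h0 : 0 ≤ facetInt (K.erase b) fun x => val (q i j) x ^ 2 :=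
      integral_nonneg fun x => sq_nonneg _
    have hle : T.facetSize h (K.erase b) ≤ σ ^ 2 *
        inner ℝ (w - b) (WithLp.toLp 2 (normal K (K.erase b))) := by
      calc T.facetSize h (K.erase b) ≤ σ * h K := hsize
        _ ≤ σ * (σ * r) := by gcongr
        _ = σ ^ 2 * r := by ring
        _ ≤ _ := by
          gcongr
          linarith
    calc T.facetSize h (K.erase b) * facetInt (K.erase b) (fun x => val (q i j) x ^ 2)
        ≤ σ ^ 2 * inner ℝ (w - b) (WithLp.toLp 2 (normal K (K.erase b))) *
          facetInt (K.erase b) (fun x => val (q i j) x ^ 2) := by gcongr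
      _ = σ ^ 2 * (inner ℝ (w - b) (WithLp.toLp 2 (normal K (K.erase b))) *
          facetInt (K.erase b) (fun x => val (q i j) x ^ 2)) := by ring
      _ ≤ σ ^ 2 * (C * cellInt K fun x => val (q i j) x ^ 2) := by gcongr
      _ = _ := by ring
  refine (Finset.sum_le_sum hbound).trans (le_of_eq ?_)
  rw [Triangulation.sum_facetsOf hK (fun _ => σ ^ 2 * C * _), Finset.sum_const,
    Triangulation.card_cell hK, nsmul_eq_mul]
  push_cast
  ring

/-! ### The energy identity -/

theorem grad_neg {d : ℕ} (p : Poly d) (x : E d) : grad (-p) x = -grad p x := by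
  ext j
  simp [grad]

theorem vval_neg {d : ℕ} (u : Fin d → Poly d) (x : E d) : vval (fun i => -u i) x = -vval u x := by
  ext i
  simp [vval]

namespace Scheme

variable {n : ℕ} {Ω : Set (E (n + 1))} (S : Scheme (n + 1) Ω) (U : Fields (n + 1))

/-- The facet integrand in the energy balance. -/
def dissipation (K F : Finset (E (n + 1))) (x : E (n + 1)) : ℝ :=
  (1 / 2 - upwind (S.flux U K F x)) * S.flux U K F x * (jump U K F x ⬝ᵥ jump U K F x) +
    4 * S.ν * (jump U K F x ⬝ᵥ (symGrad (U.u K) x *ᵥ normal K F)) +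
    2 * S.ν * (S.α / S.hF F) * (jump U K F x ⬝ᵥ jump U K F x) +
    S.β * S.hF F / (S.ν + 1) * (val (U.pb F) x - val (U.p K) x) ^ 2

theorem continuous_dissipation (K F : Finset (E (n + 1))) : Continuous (S.dissipation U K F) := by
  unfold dissipation
  simp only [sub_mul, upwind_mul_self]
  fun_prop

/-- The test function `(u, -ū, -p, -p̄)`. -/
def energyTest {d : ℕ} (U : Fields d) : Fields d where
  u := U.u
  ub F i := -U.ub F i
  p K := -U.p K
  pb F := -U.pb F

theorem inSpace_energyTest {U : Fields (n + 1)} (h : S.InSpace U) : S.InSpace (energyTest U) := by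
  obtain ⟨h1, ⟨h2, h3, h4⟩, h5, h6, h7⟩ := h
  refine ⟨h1, ⟨fun F hF i => ?_, fun F hF => ?_, fun hc F hF F' hF' x hx => ?_⟩, fun K hK => ?_,
    fun F hF => ?_, fun hc F hF F' hF' x hx => ?_⟩
  · simpa [energyTest] using h2 F hF i
  · filter_upwards [h3 F hF] with x hx
    simp only [energyTest, vval_neg, hx, neg_zero]
  · simp only [energyTest, vval_neg, h4 hc F hF F' hF' x hx]
  · simpa [energyTest] using h5 K hK
  · simpa [energyTest] using h6 F hF
  · simp only [energyTest, val_neg, h7 hc F hF F' hF' x hx]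

/-- The boundary terms of the tested scheme add up to the dissipation. -/
theorem sumBdry_energyTest :
    1 / 2 * S.mesh.sumBdry (fun K F x =>
        S.flux U K F x * (vval (U.u K) x ⬝ᵥ vval (U.u K) x))
      + S.mesh.sumBdry (fun K F x =>
        upwind (S.flux U K F x) * S.flux U K F x * (jump U K F x ⬝ᵥ vval (U.u K) x))
      + S.mesh.sumBdry (fun K F x => (S.sigmaHat U K F x *ᵥ normal K F) ⬝ᵥ vval (U.u K) x)
      + S.mesh.sumBdry (fun K F x =>
        2 * S.ν * (jump U K F x ⬝ᵥ (symGrad (U.u K) x *ᵥ normal K F)))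
      + 1 / 2 * S.mesh.sumBdry (fun K F x =>
        S.flux U K F x * (vval (U.u K) x ⬝ᵥ -vval (U.ub F) x))
      - 1 / 2 * S.mesh.sumBdry (fun K F x =>
        S.flux U K F x * (jump U K F x ⬝ᵥ -vval (U.ub F) x))
      + S.mesh.sumBdry (fun K F x =>
        upwind (S.flux U K F x) * S.flux U K F x * (jump U K F x ⬝ᵥ -vval (U.ub F) x))
      + S.mesh.sumBdry (fun K F x => (S.sigmaHat U K F x *ᵥ normal K F) ⬝ᵥ -vval (U.ub F) x)
      - S.mesh.sumBdry (fun K F x => S.flux U K F x * -val (U.p K) x)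
      + S.mesh.sumBdry (fun K F x => S.flux U K F x * -val (U.pb F) x)
      - S.mesh.sumBdry (fun K F x => val (U.p K) x * (vval (U.u K) x ⬝ᵥ normal K F))
      + S.mesh.sumBdry (fun K F x => (val (U.pb F) x • vval (U.ub F) x) ⬝ᵥ normal K F) =
    S.mesh.sumBdry (S.dissipation U) := by
  -- The twelve sums are put under one integral with their signs, which reduces the claim to a
  -- pointwise identity.
  have h := S.mesh.sum_mul_sumBdry
    ![1 / 2, 1, 1, 1, 1 / 2, -(1 / 2), 1, 1, -1, 1, -1, 1]
    ![fun K F x => S.flux U K F x * (vval (U.u K) x ⬝ᵥ vval (U.u K) x),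
      fun K F x => upwind (S.flux U K F x) * S.flux U K F x * (jump U K F x ⬝ᵥ vval (U.u K) x),
      fun K F x => (S.sigmaHat U K F x *ᵥ normal K F) ⬝ᵥ vval (U.u K) x,
      fun K F x => 2 * S.ν * (jump U K F x ⬝ᵥ (symGrad (U.u K) x *ᵥ normal K F)),
      fun K F x => S.flux U K F x * (vval (U.u K) x ⬝ᵥ -vval (U.ub F) x),
      fun K F x => S.flux U K F x * (jump U K F x ⬝ᵥ -vval (U.ub F) x),
      fun K F x => upwind (S.flux U K F x) * S.flux U K F x * (jump U K F x ⬝ᵥ -vval (U.ub F) x),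
      fun K F x => (S.sigmaHat U K F x *ᵥ normal K F) ⬝ᵥ -vval (U.ub F) x,
      fun K F x => S.flux U K F x * -val (U.p K) x,
      fun K F x => S.flux U K F x * -val (U.pb F) x,
      fun K F x => val (U.p K) x * (vval (U.u K) x ⬝ᵥ normal K F),
      fun K F x => (val (U.pb F) x • vval (U.ub F) x) ⬝ᵥ normal K F] (by
    simp only [Fin.forall_fin_succ, Matrix.cons_val_zero, Matrix.cons_val_succ, IsEmpty.forall_iff,
      and_true]
    refine ⟨?_, ?_, ?_, ?_, ?_, ?_, ?_, ?_, ?_, ?_, ?_, ?_⟩ <;> intro K F <;> fun_prop)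
  simp only [Fin.sum_univ_succ, Fin.sum_univ_zero, Matrix.cons_val_zero, Matrix.cons_val_succ,
    add_zero] at h
  rw [← S.mesh.sumBdry_congr (G := fun K F x => _) (H := S.dissipation U) ?_, ← h]
  · ring
  · intro K hK F hF x
    have hn := Triangulation.normal_dotProduct_self hK hF
    have hfl := S.flux_eq U K F x hn
    simp only [S.sigmaHat_mulVec_dotProduct U K F x hn, dissipation]
    rw [← sub_eq_zero]
    set φ := S.flux U K F x
    set lam := upwind φ
    simp only [jump, sub_dotProduct, dotProduct_sub, dotProduct_neg, neg_dotProduct,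
      smul_dotProduct, smul_eq_mul, dotProduct_comm (vval (U.ub F) x) (vval (U.u K) x)]
    -- The pressure terms add up to `(p̄ - p) (u · n - φ)`, which the formula for the flux turns
    -- into the `β` term. Elsewhere `φ` and `lam` are mere symbols.
    linear_combination -(val (U.pb F) x - val (U.p K) x) * hfl

end Scheme

/-! ### Signs of the remaining terms and the energy inequality -/

theorem Triangulation.facetSize_pos {n : ℕ} {Ω : Set (E (n + 1))} {T : Triangulation (n + 1) Ω}
    {h : Finset (E (n + 1)) → ℝ} (hh : ∀ K ∈ T.cells, 0 < h K) {K F : Finset (E (n + 1))}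
    (hK : K ∈ T.cells) (hF : F ∈ T.facetsOf K) : 0 < T.facetSize h F := by
  have hKF : K ∈ T.cellsAt F := by
    simp only [cellsAt, Finset.mem_filter]
    exact ⟨hK, (T.mem_facetsOf.1 hF).2⟩
  refine div_pos (Finset.sum_pos (fun K' hK' => hh K' ?_) ⟨K, hKF⟩)
    (Nat.cast_pos.2 (Finset.card_pos.2 ⟨K, hKF⟩))
  simp only [cellsAt, Finset.mem_filter] at hK'
  exact hK'.1

namespace Scheme

variable {n : ℕ} {Ω : Set (E (n + 1))} {S : Scheme (n + 1) Ω}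

/-- The dissipation on facets is controlled from below by the viscous terms in the cells. -/
theorem neg_viscous_le_sumBdry_dissipation (U : Fields (n + 1)) {C : ℝ} (hC : 0 < C)
    (hα : C ≤ S.α) (hν : 0 ≤ S.ν) (hβ : 0 ≤ S.β) (hsize : ∀ K ∈ S.mesh.cells, 0 < S.size K)
    (htr : ∀ K ∈ S.mesh.cells,
      ∑ F ∈ S.mesh.facetsOf K, S.mesh.facetSize S.size F *
          facetInt F (fun x => frob (symGrad (U.u K) x) (symGrad (U.u K) x)) ≤
        C * cellInt K fun x => frob (symGrad (U.u K) x) (symGrad (U.u K) x)) :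
    -(2 * S.ν * S.mesh.sumCells fun K x => frob (symGrad (U.u K) x) (symGrad (U.u K) x)) ≤
      S.mesh.sumBdry (S.dissipation U) := by
  have hα0 : 0 < S.α := hC.trans_le hα
  rw [Triangulation.sumCells, Finset.mul_sum, ← Finset.sum_neg_distrib]
  refine Finset.sum_le_sum fun K hK => ?_
  set V := cellInt K fun x => frob (symGrad (U.u K) x) (symGrad (U.u K) x) with hV
  have hV0 : 0 ≤ V := integral_nonneg fun x =>
    Finset.sum_nonneg fun i _ => Finset.sum_nonneg fun j _ => mul_self_nonneg _
  have hfacet : ∀ F ∈ S.mesh.facetsOf K,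
      -(2 * S.ν / S.α) * (S.mesh.facetSize S.size F *
        facetInt F (fun x => frob (symGrad (U.u K) x) (symGrad (U.u K) x))) ≤
      facetInt F (S.dissipation U K F) := by
    intro F hF
    have hc := Triangulation.card_facet (S.mesh.mem_facetsOf.1 hF).1
    have hn := Triangulation.normal_dotProduct_self hK hF
    have hh : 0 < S.hF F := Triangulation.facetSize_pos hsize hK hF
    rw [← mul_assoc, ← facetInt_const_mul]
    refine integral_mono (integrableOn_facet hc (by fun_prop))
      (integrableOn_facet hc (S.continuous_dissipation U K F)) fun x => ?_
    -- The penalty is spent entirely on the consistency term; the upwind and `β` terms are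
    -- nonnegative and are dropped.
    have h1 := neg_frob_le_penalty (symGrad (U.u K) x) hn (jump U K F x) hν hα0 hh
    have h2 : 0 ≤ (1 / 2 - upwind (S.flux U K F x)) * S.flux U K F x *
        (jump U K F x ⬝ᵥ jump U K F x) :=
      mul_nonneg (half_sub_upwind_mul_nonneg _) (Finset.sum_nonneg fun i _ => mul_self_nonneg _)
    have h3 : 0 ≤ S.β * S.hF F / (S.ν + 1) * (val (U.pb F) x - val (U.p K) x) ^ 2 := by
      positivity
    have h4 : -(2 * S.ν / S.α) * S.mesh.facetSize S.size F *
        frob (symGrad (U.u K) x) (symGrad (U.u K) x) =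
        -(2 * S.ν * (S.hF F / S.α) * frob (symGrad (U.u K) x) (symGrad (U.u K) x)) := by
      rw [show S.hF F = S.mesh.facetSize S.size F from rfl]
      ring
    simp only [dissipation]
    linarith
  refine le_trans ?_ (Finset.sum_le_sum hfacet)
  rw [← Finset.mul_sum]
  -- The bound `C ≤ α` compensates the factor `1 / α` left by Young's inequality.
  have h1 : ∑ F ∈ S.mesh.facetsOf K, S.mesh.facetSize S.size F *
      facetInt F (fun x => frob (symGrad (U.u K) x) (symGrad (U.u K) x)) ≤ S.α * V :=
    (htr K hK).trans (mul_le_mul_of_nonneg_right hα hV0)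
  have h2 : 2 * S.ν / S.α * (∑ F ∈ S.mesh.facetsOf K, S.mesh.facetSize S.size F *
      facetInt F (fun x => frob (symGrad (U.u K) x) (symGrad (U.u K) x))) ≤
      2 * S.ν / S.α * (S.α * V) := mul_le_mul_of_nonneg_left h1 (by positivity)
  have h3 : 2 * S.ν / S.α * (S.α * V) = 2 * S.ν * V := by
    field_simp
  linarith

/-- The integrand is `-|ū · n| |ū|² / 2`, where the minus sign comes from the test function `-ū`. -/
theorem extIntOn_outflow_nonneg (U : Fields (n + 1)) (Γ : Set (E (n + 1))) :
    S.mesh.extIntOn Γ (fun K F x =>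
      (1 / 2 - upwind (vval (U.ub F) x ⬝ᵥ normal K F)) * (vval (U.ub F) x ⬝ᵥ normal K F) *
        (vval (U.ub F) x ⬝ᵥ -vval (U.ub F) x)) ≤ 0 := by
  refine Finset.sum_nonpos fun K _ => Finset.sum_nonpos fun F _ => integral_nonpos fun x => ?_
  refine mul_nonpos_of_nonneg_of_nonpos (half_sub_upwind_mul_nonneg _) ?_
  rw [dotProduct_neg, neg_nonpos]
  exact Finset.sum_nonneg fun i _ => mul_self_nonneg _

/-- The energy inequality, from the scheme tested with `(u, -ū, -p, -p̄)`. -/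
theorem sumCells_deriv_nonpos {U : Fields (n + 1)} {ut : Finset (E (n + 1)) → E (n + 1) →
      Fin (n + 1) → ℝ} {v : Finset (E (n + 1)) → Fin (n + 1) → Poly (n + 1)}
    (hut : ∀ K ∈ S.mesh.cells, ∀ x, ut K x = vval (v K) x) (hχ : S.χ = 1 / 2)
    (hdis : -(2 * S.ν * S.mesh.sumCells fun K x => frob (symGrad (U.u K) x) (symGrad (U.u K) x)) ≤
      S.mesh.sumBdry (S.dissipation U))
    (hres : S.residual (fun _ => 0) (fun _ => 0) ut U (energyTest U) = 0) :
    S.mesh.sumCells (fun K x => vval (v K) x ⬝ᵥ vval (U.u K) x) ≤ 0 := by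
  have hdom : S.mesh.domInt (fun K x => ut K x ⬝ᵥ vval (U.u K) x) =
      S.mesh.sumCells fun K x => vval (v K) x ⬝ᵥ vval (U.u K) x := by
    rw [S.mesh.domInt_congr (g' := fun K x => vval (v K) x ⬝ᵥ vval (U.u K) x)
      fun K hK x => by rw [hut K hK x]]
    exact S.mesh.domInt_eq_sumCells fun K _ => by fun_prop
  have hf : S.mesh.domInt (fun K x => (0 : Fin (n + 1) → ℝ) ⬝ᵥ vval (U.u K) x) = 0 := by
    simp [Triangulation.domInt, Triangulation.glue]
  have hg : S.mesh.extIntOn S.ΓN (fun _ F x => (0 : Fin (n + 1) → ℝ) ⬝ᵥ -vval (U.ub F) x) = 0 := by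
    simp [Triangulation.extIntOn, facetIntOn]
  have hconv : S.mesh.sumCells (fun K x =>
      frob (Matrix.vecMulVec (vval (U.u K) x) (vval (U.u K) x)) (vgrad (U.u K) x)) =
      S.mesh.sumCells (fun K x => (vgrad (U.u K) x *ᵥ vval (U.u K) x) ⬝ᵥ vval (U.u K) x) := by
    simp only [frob_vecMulVec_self]
  -- The viscous dissipation is split off, and the pressure terms take the form required by
  -- `sumCells_div_add_grad`.
  have hcells : S.mesh.sumCells (fun K x => vval (U.u K) x ⬝ᵥ -grad (U.p K) x) -
      S.mesh.sumCells (fun K x => frob (S.sigma U K x) (vgrad (U.u K) x)) =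
      2 * S.ν * S.mesh.sumCells (fun K x => frob (symGrad (U.u K) x) (symGrad (U.u K) x)) -
      S.mesh.sumCells (fun K x => (∑ i, val (U.p K) x * vgrad (U.u K) x i i) +
        vval (U.u K) x ⬝ᵥ grad (U.p K) x) := by
    simp only [Triangulation.sumCells, Finset.mul_sum, ← Finset.sum_sub_distrib]
    refine Finset.sum_congr rfl fun K _ => ?_
    have hvg : ∀ i, Continuous fun x => vgrad (U.u K) x i i := fun i => continuous_val _
    simp only [cellInt, frob_sigma_vgrad]
    rw [← integral_const_mul, ← integral_sub (integrableOn_cell K (by fun_prop))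
      (integrableOn_cell K (by fun_prop)), ← integral_sub (integrableOn_cell K (by fun_prop))
      (integrableOn_cell K (by fun_prop))]
    congr 1
    ext x
    rw [dotProduct_neg]
    ring
  rw [S.mesh.sumCells_div_add_grad] at hcells
  -- The normal fluxes of the single-valued field `p̄ ū` cancel on interior facets; on `∂Ω` they
  -- match the boundary term of `Fcb`.
  have hpress : S.mesh.sumBdry (fun K F x => (val (U.pb F) x • vval (U.ub F) x) ⬝ᵥ normal K F) =
      -S.mesh.extInt (fun K F x => (vval (U.ub F) x ⬝ᵥ normal K F) * -val (U.pb F) x) := by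
    rw [S.mesh.sumBdry_eq_extInt fun F x => val (U.pb F) x • vval (U.ub F) x]
    simp only [Triangulation.extInt, facetInt, mul_neg, integral_neg, Finset.sum_neg_distrib,
      neg_neg, smul_dotProduct, smul_eq_mul, mul_comm]
  have hN := S.extIntOn_outflow_nonneg U S.ΓN
  have hB := S.sumBdry_energyTest U
  simp only [residual, Fm, Fmb, Fc, Fcb, energyTest, vval_neg, grad_neg, val_neg, hχ, hdom, hf, hg,
    hconv] at hres
  linarith

end Scheme

end HybridNS

end

/-! ### The stability theorem -/

theorem mainTheorem1 (d : ℕ) (hd : 1 ≤ d) (hd3 : d ≤ 3) (k : ℕ) (hk : 0 < k)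
    (σ : ℝ) (hσ : 1 ≤ σ) :
    ∃ α₀ : ℝ, 0 < α₀ ∧
      ∀ (Ω : Set (HybridNS.E d)) (S : HybridNS.Scheme d Ω),
        S.IsAdmissible → S.mesh.IsRegular S.size σ → S.k = k → S.χ = 1 / 2 → α₀ ≤ S.α →
        ∀ (tN : ℝ), 0 < tN → ∀ U : ℝ → HybridNS.Fields d,
          S.IsSolution (fun _ _ => 0) (fun _ _ => 0) (Set.Ioc 0 tN) U →
          DifferentiableOn ℝ (fun t => S.energy (U t)) (Set.Ioc 0 tN) ∧
          (∀ t ∈ Set.Ioc 0 tN,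
            derivWithin (fun s => S.energy (U s)) (Set.Ioc 0 tN) t ≤ 0) ∧
          AntitoneOn (fun t => S.energy (U t)) (Set.Ioc 0 tN) := by
  obtain ⟨n, rfl⟩ : ∃ n, d = n + 1 := ⟨d - 1, by omega⟩
  obtain ⟨C, hC, htr⟩ := HybridNS.exists_trace_symGrad n k hσ
  -- The threshold `α₀` is the constant of the trace inequality.
  refine ⟨C, hC, fun Ω S hS hreg hSk hχ hα tN _ U hU => ?_⟩
  have hI : UniqueDiffOn ℝ (Set.Ioc 0 tN) := uniqueDiffOn_Ioc 0 tN
  have key : ∀ t ∈ Set.Ioc 0 tN, ∃ E' ≤ (0 : ℝ),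
      HasDerivWithinAt (fun s => S.energy (U s)) E' (Set.Ioc 0 tN) t := by
    intro t ht
    obtain ⟨v, hv, hE⟩ := hU.exists_polynomial_deriv ht (hI t ht)
    refine ⟨_, ?_, hE⟩
    have hdis := HybridNS.Scheme.neg_viscous_le_sumBdry_dissipation (U t) hC hα hS.ν_nonneg
      hS.β_nonneg hreg.1 fun K hK => htr S.mesh hreg K hK _ fun i =>
        hSk ▸ (hU.mem t ht).1 K hK i
    have := HybridNS.Scheme.sumCells_deriv_nonpos
      (fun K hK x => funext fun i => hv K hK i x) hχ hdis
      (hU.eq t ht _ (S.inSpace_energyTest (hU.mem t ht)))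
    linarith
  have hdiff : DifferentiableOn ℝ (fun t => S.energy (U t)) (Set.Ioc 0 tN) := fun t ht =>
    let ⟨_, _, h⟩ := key t ht
    h.differentiableWithinAt
  have hderiv : ∀ t ∈ Set.Ioc 0 tN,
      derivWithin (fun s => S.energy (U s)) (Set.Ioc 0 tN) t ≤ 0 := fun t ht => by
    obtain ⟨E', hE', h⟩ := key t ht
    rwa [h.derivWithin (hI t ht)]
  refine ⟨hdiff, hderiv, ?_⟩
  -- Monotonicity needs the derivative only in the interior, where the derivative within the
  -- interval is the ordinary one.
  refine antitoneOn_of_deriv_nonpos (convex_Ioc 0 tN) hdiff.continuousOn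
    (hdiff.mono interior_subset) fun t ht => ?_
  rw [← derivWithin_of_mem_nhds (mem_interior_iff_mem_nhds.1 ht)]
  exact hderiv t (interior_subset ht)
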